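/- Let $0<l\le 1$. Consider the double integrator $\dot x_1=x_2$, $\dot x_2=u$ with measurable controls $-1\le u(t)\le 1$, and the problem of steering an initial state $x_0$ lying outside the disc of radius $l$ (that is, $|x_0|>l$) to the circle $\mathscr C=\{x_1^2+x_2^2=l^2\}$ in minimum time. Let $V(x_0)$ be the infimum of the times at which $\mathscr C$ can be reached from $x_0$. Put $\Theta=(0,\pi)\cup(\pi,2\pi)$ and let $n_\theta=(\cos\theta,\sin\theta)$ be the outward normal of $\mathscr C$ at $l\,n_\theta$. Then the following hold. 1. The usable part of $\mathscr C$ (where $\min_{|u|\le1}\langle n_\theta,(x_2,u)\rangle<0$) is $\{l\,n_\theta:\theta\in\Theta\}$, its boundary (where the minimum is $0$) is $\{(-l,0),(l,0)\}$, and the non-usable part (where the minimum is $>0$) is empty. 2. For $\theta\in\Theta$ consider, in retrograde time $\tau\ge0$, the characteristic system $x_1'=-x_2$, $x_2'=\operatorname{sign}\lambda_2$, $\lambda_1'=0$, $\lambda_2'=\lambda_1$ with $x(0)=l\,n_\theta$, $\lambda(0)=a\,n_\theta$ for some $a>0$, and $1+\lambda_1x_2-|\lambda_2|=0$ at $\tau=0$.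 It has exactly one solution, denoted $X(\theta,\tau),\lambda(\theta,\tau)$. Here $$\lambda_1=\frac{\cos\theta}{|\sin\theta|-l\sin\theta\cos\theta},\qquad \lambda_2=\frac{\sin\theta+\tau\cos\theta}{|\sin\theta|-l\sin\theta\cos\theta},$$ and, with $\bar\phi=\arctan\tau$, the state $X(\theta,\tau)=(x_1,x_2)$ is - $\bigl(l(\cos\theta-\tau\sin\theta)-\tfrac12\tau^2,\ l\sin\theta+\tau\bigr)$ for $0<\theta<\pi-\bar\phi$; - $\bigl(l(\cos\theta-\tau\sin\theta)+\tfrac12\tau^2+\tan^2\theta+2\tau\tan\theta,\ l\sin\theta-2\tan\theta-\tau\bigr)$ for $\pi-\bar\phi\le\theta<\pi$; - $\bigl(l(\cos\theta-\tau\sin\theta)+\tfrac12\tau^2,\ l\sin\theta-\tau\bigr)$ for $\pi<\theta<2\pi-\bar\phi$; - $\bigl(l(\cos\theta-\tau\sin\theta)-\tfrac12\tau^2-\tan^2\theta-2\tau\tan\theta,\ l\sin\theta+2\tan\theta+\tau\bigr)$ for $2\pi-\bar\phi\le\theta<2\pi$. In these four cases $X(\theta,\tau)$ lies, respectively, on the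 parabolas $x_1=-\tfrac12x_2^2+l\cos\theta+\tfrac12l^2\sin^2\theta$; $x_1=\tfrac12x_2^2+l\cos\theta+2l\tfrac{\sin^2\theta}{\cos\theta}-\tfrac12l^2\sin^2\theta-\tan^2\theta$; $x_1=\tfrac12x_2^2+l\cos\theta-\tfrac12l^2\sin^2\theta$; $x_1=-\tfrac12x_2^2+l\cos\theta+2l\tfrac{\sin^2\theta}{\cos\theta}+\tfrac12l^2\sin^2\theta+\tan^2\theta$. 3. For all $\tau\ge 0$, $\lambda_2>0$ if $\theta\in(0,\frac\pi2]$ and $\lambda_2<0$ if $\theta\in(\pi,\frac{3\pi}2]$. For $\theta\in(\frac\pi2,\pi)$, $\lambda_2$ changes sign exactly once, at $\tau=-\tan\theta>0$, from positive to negative; for $\theta\in(\frac{3\pi}2,2\pi)$ likewise, from negative to positive. The switching points $X(\theta,-\tan\theta)$ form the two switching lines $$x_1=\tfrac{l}{\cos\theta}-\tfrac12\tan^2\theta,\quad x_2=l\sin\theta-\tan\theta,\quad \theta\in(\tfrac\pi2,\pi),$$ $$x_1=\tfrac{l}{\cos\theta}+\tfrac12\tan^2\theta,\quad x_2=l\sin\theta+\tan\theta,\quad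 \theta\in(\tfrac{3\pi}2,2\pi).$$ The first tends to $(-l,0)$ as $\theta\to\pi^-$, the second to $(l,0)$ as $\theta\to2\pi^-$. With $r=\sqrt{l^2+1+2|x_1|}$, the first is the graph of $s(x_1)=\sqrt2\,\frac{r}{r-l}\sqrt{l^2+|x_1|-l r}$ over $x_1<-l$, and the second is the graph of $s(x_1)=-\sqrt2\,\frac{r}{r-l}\sqrt{l^2+|x_1|-l r}$ over $x_1>l$. The same formulas give $s(\pm l)=0$; put $s(x_1)=0$ for $|x_1|<l$. 4. The map $(\theta,\tau)\mapsto X(\theta,\tau)$ is a bijection from $\Theta\times(0,\infty)$ onto the set of states outside the disc that do not lie on the two arcs $\{(l-\frac12\tau^2,\tau):\tau>0\}$ and $\{(-l+\frac12\tau^2,-\tau):\tau>0\}$. From every state outside the disc the minimum time $V$ is attained and positive, and for every $\tau>0$ the isochrone $\{|x|>l,\ V(x)=\tau\}$ equals $\{X(\theta,\tau):\theta\in\Theta\}\cup\{(l-\frac12\tau^2,\tau),(-l+\frac12\tau^2,-\tau)\}$. 5. For $\theta\in\Theta$ and $\tau>0$, $V$ is differentiable at $X(\theta,\tau)$ with $\nabla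 V=\lambda(\theta,\tau)$, and there $1+\lambda_1x_2-|\lambda_2|=0$. The control $u^*(t)=-\operatorname{sign}\lambda_2(\theta,\tau-t)$, with trajectory $t\mapsto X(\theta,\tau-t)$, $0\le t\le\tau$, is optimal from $X(\theta,\tau)$, and every optimal control from there agrees with it almost everywhere and has the same trajectory. Moreover $-\operatorname{sign}\lambda_2(\theta,\tau)=\kappa(X(\theta,\tau))$, where $\kappa(x)=-\operatorname{sign}(x_2-s(x_1))$; that is, the optimal control is $-1$ above the switching lines and $+1$ below them. 6. The state feedback $\kappa$ is time-optimal: from every $x_0$ with $|x_0|>l$ there is an admissible trajectory that stays outside the disc until it reaches $\mathscr C$ in the minimum time $V(x_0)$ and satisfies $u(t)=\kappa(x(t))$ for almost every $t$. For every admissible trajectory from $x_0$ on $[0,T]$ that is outside the disc on $[0,T)$, one has $V(x(T))=V(x_0)-T$ if and only if $u(t)=\kappa(x(t))$ for almost every $t\in[0,T]$. -/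

import Mathlib

open Real Set Filter Topology MeasureTheory

namespace DoubleIntegrator

noncomputable section

/-- The circular terminal manifold of radius `l` in the `(x₁, x₂)` plane. -/
def circleTarget (l : ℝ) : Set (ℝ × ℝ) := {p | p.1 ^ 2 + p.2 ^ 2 = l ^ 2}

/-- The states outside the target disc. -/
def exterior (l : ℝ) : Set (ℝ × ℝ) := {p | l ^ 2 < p.1 ^ 2 + p.2 ^ 2}

/-- Right-hand side of the dynamics `ẋ₁ = x₂`, `ẋ₂ = u`. -/
def vectorField (p : ℝ × ℝ) (u : ℝ) : ℝ × ℝ := (p.2, u)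

/-- `u` is an admissible control on `[0, T]` (measurable, with values in `[-1, 1]`) and `x` is the
corresponding (Carathéodory) solution of `ẋ₁ = x₂`, `ẋ₂ = u` with `x(0) = x₀`. -/
structure IsTrajectory (u : ℝ → ℝ) (x : ℝ → ℝ × ℝ) (x₀ : ℝ × ℝ) (T : ℝ) : Prop where
  nonneg : 0 ≤ T
  measurable : Measurable u
  bounded : ∀ t ∈ Icc 0 T, u t ∈ Icc (-1 : ℝ) 1
  fst_eq : ∀ t ∈ Icc 0 T, (x t).1 = x₀.1 + ∫ s in (0 : ℝ)..t, (vectorField (x s) (u s)).1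
  snd_eq : ∀ t ∈ Icc 0 T, (x t).2 = x₀.2 + ∫ s in (0 : ℝ)..t, (vectorField (x s) (u s)).2

/-- The times at which the target can be reached from `x₀` by an admissible control. -/
def reachTimes (l : ℝ) (x₀ : ℝ × ℝ) : Set ℝ :=
  {T | ∃ u x, IsTrajectory u x x₀ T ∧ x T ∈ circleTarget l}

/-- The value function (infimal time to reach the target). -/
def value (l : ℝ) (x₀ : ℝ × ℝ) : ℝ := sInf (reachTimes l x₀)

/-- The point of the terminal manifold with polar angle `θ`. -/
def circlePoint (l θ : ℝ) : ℝ × ℝ := (l * cos θ, l * sin θ)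

/-- `⟨n, f(x, u)⟩` at the point of angle `θ`, with `n = (cos θ, sin θ)` the outward normal. -/
def normalSpeed (l θ u : ℝ) : ℝ :=
  cos θ * (vectorField (circlePoint l θ) u).1 + sin θ * (vectorField (circlePoint l θ) u).2

/-- `min_{-1 ≤ u ≤ 1} ⟨n, f(x, u)⟩`. -/
def minNormalSpeed (l θ : ℝ) : ℝ := sInf (normalSpeed l θ '' Icc (-1) 1)

/-- Usable part of the terminal manifold. -/
def UP (l : ℝ) : Set (ℝ × ℝ) :=
  {p | ∃ θ ∈ Icc 0 (2 * π), p = circlePoint l θ ∧ minNormalSpeed l θ < 0}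

/-- Boundary of the usable part. -/
def BUP (l : ℝ) : Set (ℝ × ℝ) :=
  {p | ∃ θ ∈ Icc 0 (2 * π), p = circlePoint l θ ∧ minNormalSpeed l θ = 0}

/-- Non-usable part. -/
def NUP (l : ℝ) : Set (ℝ × ℝ) :=
  {p | ∃ θ ∈ Icc 0 (2 * π), p = circlePoint l θ ∧ 0 < minNormalSpeed l θ}

/-- The angles `(0, π) ∪ (π, 2π)`. -/
def usableAngles : Set ℝ := Ioo 0 π ∪ Ioo π (2 * π)

/-- The optimal Hamiltonian `min_{|u| ≤ 1} (1 + λ₁ x₂ + λ₂ u) = 1 + λ₁ x₂ - |λ₂|`. -/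
def optHamiltonian (x p : ℝ × ℝ) : ℝ := 1 + p.1 * x.2 - |p.2|

/-- In retrograde time `τ ≥ 0`, the state `x` and the costate `p` solve the characteristic system
`x₁' = -x₂`, `x₂' = sign λ₂`, `λ₁' = 0`, `λ₂' = λ₁`, with initial state the point of angle `θ` of the
terminal manifold, initial costate a positive multiple of the outward normal there, and zero
optimal Hamiltonian at `τ = 0`. -/
structure IsCharacteristic (l θ : ℝ) (x p : ℝ → ℝ × ℝ) : Prop where
  state_zero : x 0 = circlePoint l θ
  costate_zero : ∃ a : ℝ, 0 < a ∧ p 0 = (a * cos θ, a * sin θ)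
  hamiltonian_zero : optHamiltonian (x 0) (p 0) = 0
  state_fst : ∀ τ, 0 ≤ τ → (x τ).1 = (x 0).1 + ∫ s in (0 : ℝ)..τ, -(x s).2
  state_snd : ∀ τ, 0 ≤ τ → (x τ).2 = (x 0).2 + ∫ s in (0 : ℝ)..τ, Real.sign (p s).2
  costate_fst : ∀ τ, 0 ≤ τ → (p τ).1 = (p 0).1
  costate_snd : ∀ τ, 0 ≤ τ → (p τ).2 = (p 0).2 + ∫ s in (0 : ℝ)..τ, (p s).1

/-- Closed form of the costate at retrograde time `τ` on the characteristic of angle `θ`. -/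
def charCostate (l θ τ : ℝ) : ℝ × ℝ :=
  (cos θ / (|sin θ| - l * sin θ * cos θ),
    (sin θ + τ * cos θ) / (|sin θ| - l * sin θ * cos θ))

/-- Closed form of the state at retrograde time `τ` on the characteristic of angle `θ`,
`θ ∈ (0, π) ∪ (π, 2π)`. -/
def charState (l θ τ : ℝ) : ℝ × ℝ :=
  if θ < π then
    if θ < π - arctan τ then
      (l * (cos θ - τ * sin θ) - τ ^ 2 / 2, l * sin θ + τ)
    else
      (l * (cos θ - τ * sin θ) + τ ^ 2 / 2 + tan θ ^ 2 + 2 * τ * tan θ,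
        l * sin θ - 2 * tan θ - τ)
  else
    if θ < 2 * π - arctan τ then
      (l * (cos θ - τ * sin θ) + τ ^ 2 / 2, l * sin θ - τ)
    else
      (l * (cos θ - τ * sin θ) - τ ^ 2 / 2 - tan θ ^ 2 - 2 * τ * tan θ,
        l * sin θ + 2 * tan θ + τ)

/-- The `τ`-isochrone of the family of characteristics. -/
def isochrone (l τ : ℝ) : Set (ℝ × ℝ) := (fun θ => charState l θ τ) '' usableAngles

/-- The arc `u = -1` ending at the point `(l, 0)`, at retrograde time `τ`. -/
def arcRight (l τ : ℝ) : ℝ × ℝ := (l - τ ^ 2 / 2, τ)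

/-- The arc `u = 1` ending at the point `(-l, 0)`, at retrograde time `τ`. -/
def arcLeft (l τ : ℝ) : ℝ × ℝ := (-l + τ ^ 2 / 2, -τ)

/-- First switching line, `θ ∈ (π/2, π)`. -/
def switch1 (l θ : ℝ) : ℝ × ℝ := (l / cos θ - tan θ ^ 2 / 2, l * sin θ - tan θ)

/-- Second switching line, `θ ∈ (3π/2, 2π)`. -/
def switch2 (l θ : ℝ) : ℝ × ℝ := (l / cos θ + tan θ ^ 2 / 2, l * sin θ + tan θ)

/-- The first switching line as a graph over `x₁ ≤ -l`. -/
def switchGraph1 (l x₁ : ℝ) : ℝ :=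
  √2 * (√(l ^ 2 + 1 - 2 * x₁) / (√(l ^ 2 + 1 - 2 * x₁) - l)) *
    √(l ^ 2 - x₁ - l * √(l ^ 2 + 1 - 2 * x₁))

/-- The second switching line as a graph over `x₁ ≥ l`. -/
def switchGraph2 (l x₁ : ℝ) : ℝ :=
  -√2 * (√(l ^ 2 + 1 + 2 * x₁) / (√(l ^ 2 + 1 + 2 * x₁) - l)) *
    √(l ^ 2 + x₁ - l * √(l ^ 2 + 1 + 2 * x₁))

/-- Ordinate separating the two control regions; for `-l < x₁ < l` the separation is by the
target disc itself, so that outside the disc the sign of `x₂` decides. -/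
def switchOrdinate (l x₁ : ℝ) : ℝ :=
  if x₁ ≤ -l then switchGraph1 l x₁ else if l ≤ x₁ then switchGraph2 l x₁ else 0

/-- The state-feedback law: `-1` above and `1` below the switching lines (and `0` on them). -/
def feedback (l : ℝ) (p : ℝ × ℝ) : ℝ := -Real.sign (p.2 - switchOrdinate l p.1)

end

end DoubleIntegrator

open DoubleIntegrator

namespace DoubleIntegrator

/-! The argument is one of convex duality, not of integrating a Hamilton-Jacobi equation. Pairing
the terminal state with n_θ = (cos θ, sin θ) gives a linear functional of the initial state plus ∫
σ(T - s) u(s) ds, where σ(s) = sin θ + s cos θ is `switchFun` (`IsTrajectory.pairing`). If the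
terminal state is in the disc, the pairing is at most l, and |u| ≤ 1 yields one support inequality
for each θ (`IsTrajectory.support_le`). The state `extremal l θ τ` gives equality in direction θ.
Since σ has at most one zero, equality forces u = -sign σ almost everywhere, so a trajectory from
there that is in the disc at time τ is the extremal itself (`IsTrajectory.rigidity`).

For l ≤ 1 every point of the disc can be kept in the disc (`viable`). An early arrival could
therefore be prolonged inside the disc up to time τ; rigidity would then put a state of the extremal
with positive retrograde time in the disc, which `extremal_mem_exterior` excludes. Hence the minimum
time at `extremal l θ τ` is τ, and rigidity again shows that distinct extremals do not meet
(`extremal_injective`).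

Extremals cover the exterior: for p outside the disc the largest violation of the support
inequalities over θ is positive at time 0 and nonpositive at a time at which the origin can be
reached. At an intermediate zero, the vanishing of the gap and of its derivative in θ at a
maximizing angle are two linear equations whose only solution is the extremal point
(`exists_extremal_of_supportGap_nonpos`).

The value is bounded below by the support inequality in one fixed direction, and above by applying
one fixed extremal control to neighbouring states. Both bounds are implicit functions with the same
differential, namely the costate, so the value is differentiable (`hasFDerivAt_value_extremal`).

Since extremals do not meet, the height of an extremal above the switching lines can vanish only
where σ does; one sample on each side of the switch fixes its sign (`feedback_extremal`). Finally
V(x(t)) + t is nondecreasing outside the disc. Under the feedback it is continuous with zero right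
derivative, hence constant; conversely, constancy makes the optimally continued trajectory an
extremal. The reflection x ↦ -x, θ ↦ θ + π halves the case work throughout. -/

/-- The closed disc bounded by the target circle. -/
def disc (l : ℝ) : Set (ℝ × ℝ) := {p | p.1 ^ 2 + p.2 ^ 2 ≤ l ^ 2}

lemma mem_disc_of_mem_circleTarget {l : ℝ} {p : ℝ × ℝ} (hp : p ∈ circleTarget l) : p ∈ disc l :=
  le_of_eq hp

lemma not_mem_exterior_iff {l : ℝ} {p : ℝ × ℝ} : p ∉ exterior l ↔ p ∈ disc l := by
  simp [exterior, disc]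

lemma measurable_sign : Measurable Real.sign := by
  unfold Real.sign
  exact Measurable.ite measurableSet_Iio measurable_const
    (Measurable.ite measurableSet_Ioi measurable_const measurable_const)

lemma abs_sign_le_one (r : ℝ) : |Real.sign r| ≤ 1 := by
  rcases Real.sign_apply_eq r with h | h | h <;> simp [h]

lemma sign_mem_Icc (r : ℝ) : Real.sign r ∈ Icc (-1 : ℝ) 1 := abs_le.mp (abs_sign_le_one r)

lemma sign_mul_self (r : ℝ) : Real.sign r * r = |r| := by
  rcases lt_trichotomy r 0 with h | h | h
  · rw [Real.sign_of_neg h, abs_of_neg h]; ring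
  · simp [h]
  · rw [Real.sign_of_pos h, abs_of_pos h]; ring

/-! ### Admissible trajectories -/

lemma intervalIntegrable_of_abs_le_one {u : ℝ → ℝ} (hu : Measurable u) {a b : ℝ}
    (h : ∀ t ∈ uIcc a b, |u t| ≤ 1) : IntervalIntegrable u volume a b := by
  refine IntervalIntegrable.mono_fun' (g := fun _ => (1 : ℝ)) intervalIntegrable_const
    hu.aestronglyMeasurable ?_
  refine (ae_restrict_iff' measurableSet_uIoc).2 (Eventually.of_forall fun t ht => ?_)
  exact h t (uIoc_subset_uIcc ht)

/-- Integration by parts against T - s. The control is only measurable, so its primitive is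
differentiable merely almost everywhere, and the version for absolutely continuous functions is
needed. -/
lemma integral_primitive {u : ℝ → ℝ} {T : ℝ} (hu : IntervalIntegrable u volume 0 T) :
    ∫ t in (0 : ℝ)..T, ∫ s in (0 : ℝ)..t, u s = ∫ s in (0 : ℝ)..T, (T - s) * u s := by
  have hg := hu.absolutelyContinuousOnInterval_intervalIntegral (c := 0) (by simp)
  have hf : AbsolutelyContinuousOnInterval (fun s : ℝ => T - s) 0 T := by
    refine ContDiffOn.absolutelyContinuousOnInterval ?_
    fun_prop
  have h := hf.integral_mul_deriv_eq_deriv_mul hg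
  have h1 : ∫ s in (0 : ℝ)..T, (T - s) * u s =
      ∫ s in (0 : ℝ)..T, (T - s) * deriv (fun t => ∫ s in (0 : ℝ)..t, u s) s := by
    refine intervalIntegral.integral_congr_ae ?_
    filter_upwards [hu.ae_hasDerivAt_integral] with s hs hs'
    rw [(hs (uIoc_subset_uIcc hs') 0 (by simp)).deriv]
  rw [h1, h]
  simp

namespace IsTrajectory

variable {u : ℝ → ℝ} {x : ℝ → ℝ × ℝ} {x₀ : ℝ × ℝ} {T : ℝ}

lemma abs_le_one (h : IsTrajectory u x x₀ T) {t : ℝ} (ht : t ∈ Icc 0 T) : |u t| ≤ 1 :=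
  abs_le.mpr (h.bounded t ht)

lemma intervalIntegrable (h : IsTrajectory u x x₀ T) {a b : ℝ} (ha : a ∈ Icc 0 T)
    (hb : b ∈ Icc 0 T) : IntervalIntegrable u volume a b :=
  intervalIntegrable_of_abs_le_one h.measurable fun _ ht =>
    h.abs_le_one ((ordConnected_Icc.uIcc_subset ha hb) ht)

lemma snd_formula (h : IsTrajectory u x x₀ T) {t : ℝ} (ht : t ∈ Icc 0 T) :
    (x t).2 = x₀.2 + ∫ s in (0 : ℝ)..t, u s := h.snd_eq t ht

lemma continuousOn_snd (h : IsTrajectory u x x₀ T) : ContinuousOn (fun t => (x t).2) (Icc 0 T) := by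
  have h1 : ContinuousOn (fun t => x₀.2 + ∫ s in (0 : ℝ)..t, u s) (Icc 0 T) := by
    refine continuousOn_const.add ?_
    have := (h.intervalIntegrable (left_mem_Icc.2 h.nonneg)
      (right_mem_Icc.2 h.nonneg)).absolutelyContinuousOnInterval_intervalIntegral (c := 0) (by simp)
    simpa [uIcc_of_le h.nonneg] using this.continuousOn
  exact h1.congr fun t ht => h.snd_formula ht

lemma fst_formula (h : IsTrajectory u x x₀ T) {t : ℝ} (ht : t ∈ Icc 0 T) :
    (x t).1 = x₀.1 + t * x₀.2 + ∫ s in (0 : ℝ)..t, ∫ r in (0 : ℝ)..s, u r := by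
  have h0 : (0 : ℝ) ∈ Icc 0 T := left_mem_Icc.2 h.nonneg
  have h1 : ∫ s in (0 : ℝ)..t, (vectorField (x s) (u s)).1 =
      ∫ s in (0 : ℝ)..t, (x₀.2 + ∫ r in (0 : ℝ)..s, u r) := by
    refine intervalIntegral.integral_congr fun s hs => ?_
    exact h.snd_formula ((ordConnected_Icc.uIcc_subset h0 ht) hs)
  have h2 := ((h.intervalIntegrable h0 ht).absolutelyContinuousOnInterval_intervalIntegral
    (c := 0) (by simp)).continuousOn.intervalIntegrable (μ := volume)
  rw [h.fst_eq t ht, h1, intervalIntegral.integral_add intervalIntegrable_const h2]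
  simp
  ring

lemma initial (h : IsTrajectory u x x₀ T) : x 0 = x₀ := by
  have h0 : (0 : ℝ) ∈ Icc 0 T := left_mem_Icc.2 h.nonneg
  ext
  · simpa using h.fst_formula h0
  · simpa using h.snd_formula h0

lemma fst_sub (h : IsTrajectory u x x₀ T) {a b : ℝ} (ha : a ∈ Icc 0 T) (hb : b ∈ Icc 0 T) :
    (x b).1 - (x a).1 = ∫ s in a..b, (x s).2 := by
  have h0 : (0 : ℝ) ∈ Icc 0 T := left_mem_Icc.2 h.nonneg
  have hi : ∀ c ∈ Icc 0 T, IntervalIntegrable (fun s => (x s).2) volume 0 c := fun c hc =>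
    (h.continuousOn_snd.mono (ordConnected_Icc.uIcc_subset h0 hc)).intervalIntegrable
  rw [h.fst_eq a ha, h.fst_eq b hb]
  simp only [vectorField]
  rw [← intervalIntegral.integral_interval_sub_left (hi b hb) (hi a ha)]
  ring

lemma snd_sub (h : IsTrajectory u x x₀ T) {a b : ℝ} (ha : a ∈ Icc 0 T) (hb : b ∈ Icc 0 T) :
    (x b).2 - (x a).2 = ∫ s in a..b, u s := by
  have h0 : (0 : ℝ) ∈ Icc 0 T := left_mem_Icc.2 h.nonneg
  rw [h.snd_formula ha, h.snd_formula hb,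
    ← intervalIntegral.integral_interval_sub_left (h.intervalIntegrable h0 hb)
      (h.intervalIntegrable h0 ha)]
  ring

lemma continuousOn (h : IsTrajectory u x x₀ T) : ContinuousOn x (Icc 0 T) := by
  have h0 : (0 : ℝ) ∈ Icc 0 T := left_mem_Icc.2 h.nonneg
  have hT : T ∈ Icc 0 T := right_mem_Icc.2 h.nonneg
  have hi : IntervalIntegrable (fun s => (x s).2) volume 0 T :=
    (h.continuousOn_snd.mono (ordConnected_Icc.uIcc_subset h0 hT)).intervalIntegrable
  have h1 : ContinuousOn (fun t => (x t).1) (Icc 0 T) := by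
    have : ContinuousOn (fun t => x₀.1 + ∫ s in (0 : ℝ)..t, (x s).2) (Icc 0 T) := by
      refine continuousOn_const.add ?_
      have := hi.absolutelyContinuousOnInterval_intervalIntegral (c := 0) (by simp)
      simpa [uIcc_of_le h.nonneg] using this.continuousOn
    exact this.congr fun t ht => h.fst_eq t ht
  exact h1.prodMk h.continuousOn_snd

/-- Trajectories of almost everywhere equal controls coincide. -/
lemma eqOn_of_ae_eq {v : ℝ → ℝ} {y : ℝ → ℝ × ℝ} (h : IsTrajectory u x x₀ T)
    (h' : IsTrajectory v y x₀ T) (huv : ∀ᵐ t ∂(volume.restrict (Icc 0 T)), u t = v t) :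
    ∀ t ∈ Icc 0 T, x t = y t := by
  have key : ∀ t ∈ Icc 0 T, ∫ s in (0 : ℝ)..t, u s = ∫ s in (0 : ℝ)..t, v s := by
    intro t ht
    refine intervalIntegral.integral_congr_ae ?_
    filter_upwards [(ae_restrict_iff' measurableSet_Icc).1 huv] with s hs hs'
    rw [uIoc_of_le ht.1] at hs'
    exact hs ⟨hs'.1.le, hs'.2.trans ht.2⟩
  intro t ht
  ext
  · rw [h.fst_formula ht, h'.fst_formula ht]
    congr 1
    refine intervalIntegral.integral_congr fun s hs => key s ?_
    exact (ordConnected_Icc.uIcc_subset (left_mem_Icc.2 h.nonneg) ht) hs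
  · rw [h.snd_formula ht, h'.snd_formula ht, key t ht]

lemma restrict (h : IsTrajectory u x x₀ T) {S : ℝ} (hS : S ∈ Icc 0 T) : IsTrajectory u x x₀ S where
  nonneg := hS.1
  measurable := h.measurable
  bounded t ht := h.bounded t ⟨ht.1, ht.2.trans hS.2⟩
  fst_eq t ht := h.fst_eq t ⟨ht.1, ht.2.trans hS.2⟩
  snd_eq t ht := h.snd_eq t ⟨ht.1, ht.2.trans hS.2⟩

lemma neg (h : IsTrajectory u x x₀ T) :
    IsTrajectory (fun t => -u t) (fun t => -x t) (-x₀) T where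
  nonneg := h.nonneg
  measurable := h.measurable.neg
  bounded t ht := ⟨by linarith [(h.bounded t ht).2], by linarith [(h.bounded t ht).1]⟩
  fst_eq t ht := by
    have := h.fst_eq t ht
    simp only [vectorField, Prod.fst_neg, Prod.snd_neg, intervalIntegral.integral_neg] at this ⊢
    linarith
  snd_eq t ht := by
    have := h.snd_eq t ht
    simp only [vectorField, Prod.snd_neg, intervalIntegral.integral_neg] at this ⊢
    linarith

/-- The tail of a trajectory is a trajectory. -/
lemma shift (h : IsTrajectory u x x₀ T) {a : ℝ} (ha : a ∈ Icc 0 T) :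
    IsTrajectory (fun t => u (t + a)) (fun t => x (t + a)) (x a) (T - a) where
  nonneg := sub_nonneg.2 ha.2
  measurable := h.measurable.comp (measurable_id.add_const a)
  bounded t ht := h.bounded _ ⟨by linarith [ht.1, ha.1], by linarith [ht.2]⟩
  fst_eq t ht := by
    have := h.fst_sub ha (b := t + a) ⟨by linarith [ht.1, ha.1], by linarith [ht.2]⟩
    simp only [vectorField]
    rw [intervalIntegral.integral_comp_add_right (fun s => (x s).2), zero_add]
    linarith
  snd_eq t ht := by
    have := h.snd_sub ha (b := t + a) ⟨by linarith [ht.1, ha.1], by linarith [ht.2]⟩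
    simp only [vectorField]
    rw [intervalIntegral.integral_comp_add_right u, zero_add]
    linarith

/-- Concatenation of trajectories. -/
lemma concat {v : ℝ → ℝ} {y : ℝ → ℝ × ℝ} {S : ℝ} (h : IsTrajectory u x x₀ T)
    (h' : IsTrajectory v y (x T) S) :
    IsTrajectory (fun t => if t ≤ T then u t else v (t - T))
      (fun t => if t ≤ T then x t else y (t - T)) x₀ (T + S) := by
  have h0 : (0 : ℝ) ∈ Icc 0 T := left_mem_Icc.2 h.nonneg
  have hT : T ∈ Icc 0 T := right_mem_Icc.2 h.nonneg
  have h0' : (0 : ℝ) ∈ Icc 0 S := left_mem_Icc.2 h'.nonneg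
  -- Past the junction the integral splits at T and the second piece is shifted back to 0; this one
  -- statement serves both coordinates.
  have key : ∀ (f g : ℝ → ℝ), IntervalIntegrable f volume 0 T →
      (∀ t ∈ Icc 0 S, IntervalIntegrable g volume 0 t) → ∀ t, T < t → t ≤ T + S →
      ∫ s in (0 : ℝ)..t, (if s ≤ T then f s else g (s - T)) =
        (∫ s in (0 : ℝ)..T, f s) + ∫ s in (0 : ℝ)..(t - T), g s := by
    intro f g hf hg t ht htS
    have e1 : EqOn (fun s => if s ≤ T then f s else g (s - T)) f (uIoc 0 T) := fun s hs => by
      rw [uIoc_of_le h.nonneg] at hs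
      exact if_pos hs.2
    have e2 : EqOn (fun s => if s ≤ T then f s else g (s - T)) (fun s => g (s - T)) (uIoc T t) :=
      fun s hs => by
        rw [uIoc_of_le ht.le] at hs
        exact if_neg (not_le.2 hs.1)
    have hg' := (hg (t - T) ⟨by linarith, by linarith⟩).comp_sub_right T
    simp only [zero_add, sub_add_cancel] at hg'
    rw [← intervalIntegral.integral_add_adjacent_intervals (b := T)
      (hf.congr e1.symm) (hg'.congr e2.symm)]
    congr 1
    · exact intervalIntegral.integral_congr_ae (Eventually.of_forall fun s hs => e1 hs)
    · rw [intervalIntegral.integral_congr_ae (Eventually.of_forall fun s hs => e2 hs),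
        intervalIntegral.integral_comp_sub_right g, sub_self]
  have key' : ∀ (f g : ℝ → ℝ), ∀ t, 0 ≤ t → t ≤ T →
      ∫ s in (0 : ℝ)..t, (if s ≤ T then f s else g (s - T)) = ∫ s in (0 : ℝ)..t, f s := by
    intro f g t ht0 ht
    refine intervalIntegral.integral_congr fun s hs => ?_
    rw [uIcc_of_le ht0] at hs
    exact if_pos (hs.2.trans ht)
  have hx2 : IntervalIntegrable (fun s => (x s).2) volume 0 T :=
    (h.continuousOn_snd.mono (ordConnected_Icc.uIcc_subset h0 hT)).intervalIntegrable
  have hy2 : ∀ t ∈ Icc 0 S, IntervalIntegrable (fun s => (y s).2) volume 0 t := fun t ht =>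
    (h'.continuousOn_snd.mono (ordConnected_Icc.uIcc_subset h0' ht)).intervalIntegrable
  refine ⟨add_nonneg h.nonneg h'.nonneg, ?_, ?_, ?_, ?_⟩
  · exact Measurable.ite measurableSet_Iic h.measurable
      (h'.measurable.comp (measurable_id.sub_const T))
  · intro t ht
    split_ifs with hc
    · exact h.bounded t ⟨ht.1, hc⟩
    · exact h'.bounded _ ⟨by linarith, by linarith [ht.2]⟩
  · intro t ht
    simp only [vectorField, apply_ite Prod.snd, apply_ite Prod.fst]
    split_ifs with hc
    · rw [key' (fun s => (x s).2) (fun s => (y s).2) t ht.1 hc]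
      exact h.fst_eq t ⟨ht.1, hc⟩
    · rw [key (fun s => (x s).2) (fun s => (y s).2) hx2 hy2 t (not_le.1 hc) ht.2]
      have e1 := h.fst_eq T hT
      have e2 := h'.fst_eq (t - T) ⟨by linarith, by linarith [ht.2]⟩
      simp only [vectorField] at e1 e2
      linarith
  · intro t ht
    simp only [vectorField, apply_ite Prod.snd]
    split_ifs with hc
    · rw [key' u v t ht.1 hc]
      exact h.snd_formula ⟨ht.1, hc⟩
    · rw [key u v (h.intervalIntegrable h0 hT) (fun t ht => h'.intervalIntegrable h0' ht) t
        (not_le.1 hc) ht.2]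
      have e1 := h.snd_formula hT
      have e2 := h'.snd_formula (t := t - T) ⟨by linarith, by linarith [ht.2]⟩
      linarith

end IsTrajectory

/-- The trajectory of a constant control. -/
lemma isTrajectory_const (p : ℝ × ℝ) {c : ℝ} (hc : c ∈ Icc (-1 : ℝ) 1) {T : ℝ} (hT : 0 ≤ T) :
    IsTrajectory (fun _ => c) (fun t => (p.1 + p.2 * t + c * t ^ 2 / 2, p.2 + c * t)) p T where
  nonneg := hT
  measurable := measurable_const
  bounded _ _ := hc
  fst_eq t _ := by
    simp only [vectorField]
    rw [intervalIntegral.integral_add intervalIntegrable_const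
      (by apply Continuous.intervalIntegrable; fun_prop),
      intervalIntegral.integral_const_mul]
    simp
    ring
  snd_eq t _ := by
    simp [vectorField]
    ring

/-- Every measurable control with values in `[-1, 1]` has a trajectory. -/
lemma isTrajectory_primitive {u : ℝ → ℝ} (hu : Measurable u) (hb : ∀ t, |u t| ≤ 1) (p : ℝ × ℝ)
    {T : ℝ} (hT : 0 ≤ T) :
    IsTrajectory u (fun t => (p.1 + t * p.2 + ∫ s in (0 : ℝ)..t, ∫ r in (0 : ℝ)..s, u r,
      p.2 + ∫ s in (0 : ℝ)..t, u s)) p T where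
  nonneg := hT
  measurable := hu
  bounded t _ := abs_le.1 (hb t)
  fst_eq t _ := by
    have hi : ∀ a b, IntervalIntegrable u volume a b := fun a b =>
      intervalIntegrable_of_abs_le_one hu fun t _ => hb t
    simp only [vectorField]
    rw [intervalIntegral.integral_add intervalIntegrable_const
      ((intervalIntegral.continuous_primitive hi 0).intervalIntegrable _ _)]
    simp
    ring
  snd_eq t _ := rfl

/-! ### Extremals -/

/-- The second component of the costate at retrograde time `s`, up to a positive factor. -/
noncomputable def switchFun (θ s : ℝ) : ℝ := sin θ + s * cos θ

/-- Second component of the extremal with terminal normal of angle `θ`, for an arbitrary `θ`. -/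
noncomputable def extremalSnd (l θ τ : ℝ) : ℝ :=
  l * sin θ + ∫ s in (0 : ℝ)..τ, Real.sign (switchFun θ s)

/-- The extremal with terminal normal of angle `θ` at retrograde time `τ`, for an arbitrary `θ`. -/
noncomputable def extremal (l θ τ : ℝ) : ℝ × ℝ :=
  (l * cos θ - ∫ s in (0 : ℝ)..τ, extremalSnd l θ s, extremalSnd l θ τ)

lemma continuous_switchFun (θ : ℝ) : Continuous (switchFun θ) := by
  unfold switchFun; fun_prop

lemma measurable_sign_switchFun (θ : ℝ) : Measurable fun s => Real.sign (switchFun θ s) :=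
  measurable_sign.comp (continuous_switchFun θ).measurable

lemma intervalIntegrable_sign_switchFun (θ a b : ℝ) :
    IntervalIntegrable (fun s => Real.sign (switchFun θ s)) volume a b :=
  intervalIntegrable_of_abs_le_one (measurable_sign_switchFun θ) fun _ _ => abs_sign_le_one _

lemma continuous_extremalSnd (l θ : ℝ) : Continuous (extremalSnd l θ) :=
  continuous_const.add (intervalIntegral.continuous_primitive
    (intervalIntegrable_sign_switchFun θ) 0)

lemma continuous_extremal (l θ : ℝ) : Continuous (extremal l θ) :=
  (continuous_const.sub (intervalIntegral.continuous_primitive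
    (fun a b => (continuous_extremalSnd l θ).intervalIntegrable a b) 0)).prodMk
    (continuous_extremalSnd l θ)

lemma extremal_zero (l θ : ℝ) : extremal l θ 0 = (l * cos θ, l * sin θ) := by
  simp [extremal, extremalSnd]

lemma switchFun_add_pi (θ s : ℝ) : switchFun (θ + π) s = -switchFun θ s := by
  simp [switchFun]; ring

/-- Central symmetry of the problem, through which the angles in (π, 2π) reduce to those in (0, π).
-/
lemma extremal_add_pi (l θ τ : ℝ) : extremal l (θ + π) τ = -extremal l θ τ := by
  have h : ∀ s, extremalSnd l (θ + π) s = -extremalSnd l θ s := fun s => by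
    simp [extremalSnd, switchFun_add_pi, Real.sign_neg]; ring
  ext
  · simp [extremal, h]; ring
  · simp [extremal, h]

lemma extremal_sub_two_pi (l θ τ : ℝ) : extremal l (θ - 2 * π) τ = extremal l θ τ := by
  have h := extremal_add_pi l (θ - 2 * π) τ
  have h' := extremal_add_pi l (θ - 2 * π + π) τ
  rw [h, neg_neg] at h'
  rw [← h']; ring_nf

/-- The extremal, run forward, is an admissible trajectory. -/
lemma isTrajectory_extremal (l θ : ℝ) {τ : ℝ} (hτ : 0 ≤ τ) :
    IsTrajectory (fun t => -Real.sign (switchFun θ (τ - t))) (fun t => extremal l θ (τ - t))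
      (extremal l θ τ) τ where
  nonneg := hτ
  measurable := ((measurable_sign_switchFun θ).comp (measurable_const.sub measurable_id)).neg
  bounded t _ := by
    have := sign_mem_Icc (switchFun θ (τ - t))
    exact ⟨by linarith [this.2], by linarith [this.1]⟩
  fst_eq t _ := by
    simp only [vectorField, extremal]
    rw [intervalIntegral.integral_comp_sub_left (extremalSnd l θ)]
    have := intervalIntegral.integral_interval_sub_left (μ := volume)
      ((continuous_extremalSnd l θ).intervalIntegrable 0 τ)
      ((continuous_extremalSnd l θ).intervalIntegrable 0 (τ - t))
    rw [sub_zero]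
    linarith
  snd_eq t _ := by
    simp only [vectorField, extremal, extremalSnd]
    rw [intervalIntegral.integral_neg,
      intervalIntegral.integral_comp_sub_left (fun s => Real.sign (switchFun θ s))]
    have := intervalIntegral.integral_interval_sub_left
      (intervalIntegrable_sign_switchFun θ 0 τ) (intervalIntegrable_sign_switchFun θ 0 (τ - t))
    rw [sub_zero]
    linarith

/-- As an affine function of s, `switchFun θ` has at most one zero, because sin θ and cos θ do not
vanish together. This makes extremal controls bang-bang and unique. -/
lemma ae_switchFun_ne_zero (θ : ℝ) : ∀ᵐ s : ℝ, switchFun θ s ≠ 0 := by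
  have h : {s : ℝ | switchFun θ s = 0}.Subsingleton := by
    intro s hs t ht
    simp only [switchFun, mem_ofPred_eq] at hs ht
    have h1 : (s - t) * cos θ = 0 := by linarith
    rcases mul_eq_zero.1 h1 with h1 | h1
    · linarith
    · have := sin_sq_add_cos_sq θ
      rw [h1] at hs this
      simp only [mul_zero, add_zero] at hs
      rw [hs] at this
      norm_num at this
  simpa [ae_iff] using h.measure_zero volume

/-- Duality pairing of the terminal state with the direction of angle `θ`. -/
lemma IsTrajectory.pairing {u : ℝ → ℝ} {x : ℝ → ℝ × ℝ} {x₀ : ℝ × ℝ} {T : ℝ}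
    (h : IsTrajectory u x x₀ T) (θ : ℝ) :
    cos θ * (x T).1 + sin θ * (x T).2 = cos θ * (x₀.1 + T * x₀.2) + sin θ * x₀.2 +
      ∫ s in (0 : ℝ)..T, switchFun θ (T - s) * u s := by
  have hT : T ∈ Icc 0 T := right_mem_Icc.2 h.nonneg
  have hi := h.intervalIntegrable (left_mem_Icc.2 h.nonneg) hT
  have e : ∫ s in (0 : ℝ)..T, switchFun θ (T - s) * u s =
      sin θ * (∫ s in (0 : ℝ)..T, u s) + cos θ * ∫ s in (0 : ℝ)..T, (T - s) * u s := by
    rw [← intervalIntegral.integral_const_mul, ← intervalIntegral.integral_const_mul,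
      ← intervalIntegral.integral_add (hi.const_mul _)
        ((hi.continuousOn_mul (by fun_prop)).const_mul _)]
    refine intervalIntegral.integral_congr fun s _ => ?_
    simp only [switchFun]; ring
  rw [e, ← integral_primitive hi, h.fst_formula hT, h.snd_formula hT]
  ring

/-- Pairing of the extremal with the direction of angle `φ`. -/
lemma extremal_pairing (l θ φ : ℝ) {τ : ℝ} (hτ : 0 ≤ τ) :
    cos φ * ((extremal l θ τ).1 + τ * (extremal l θ τ).2) + sin φ * (extremal l θ τ).2 =
      l * cos (φ - θ) + ∫ s in (0 : ℝ)..τ, switchFun φ s * Real.sign (switchFun θ s) := by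
  have h := (isTrajectory_extremal l θ hτ).pairing φ
  simp only [sub_self, extremal_zero, mul_neg, intervalIntegral.integral_neg] at h
  rw [intervalIntegral.integral_comp_sub_left
    (fun s => switchFun φ s * Real.sign (switchFun θ s))] at h
  simp only [sub_self, sub_zero] at h
  rw [cos_sub]
  linarith

/-- The extremal attains equality in the support inequality of its own direction. -/
lemma extremal_pairing_self (l θ : ℝ) {τ : ℝ} (hτ : 0 ≤ τ) :
    cos θ * ((extremal l θ τ).1 + τ * (extremal l θ τ).2) + sin θ * (extremal l θ τ).2 =
      l + ∫ s in (0 : ℝ)..τ, |switchFun θ s| := by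
  rw [extremal_pairing l θ θ hτ]
  simp [mul_comm (switchFun θ _), sign_mul_self]

/-- Cauchy-Schwarz with a unit vector: l is the support function of the disc. -/
lemma cos_mul_add_sin_mul_le {l : ℝ} (hl : 0 ≤ l) {p : ℝ × ℝ} (hp : p ∈ disc l) (θ : ℝ) :
    cos θ * p.1 + sin θ * p.2 ≤ l := by
  refine abs_le_of_sq_le_sq' ?_ hl |>.2
  have hp' : p.1 ^ 2 + p.2 ^ 2 ≤ l ^ 2 := hp
  nlinarith [sq_nonneg (cos θ * p.2 - sin θ * p.1), sin_sq_add_cos_sq θ]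

lemma abs_switchFun_integral_comp (θ τ : ℝ) :
    ∫ s in (0 : ℝ)..τ, |switchFun θ (τ - s)| = ∫ s in (0 : ℝ)..τ, |switchFun θ s| := by
  rw [intervalIntegral.integral_comp_sub_left (fun s => |switchFun θ s|)]
  simp

lemma intervalIntegrable_switchFun_comp_mul {u : ℝ → ℝ} {x : ℝ → ℝ × ℝ} {x₀ : ℝ × ℝ} {τ : ℝ}
    (h : IsTrajectory u x x₀ τ) (θ : ℝ) :
    IntervalIntegrable (fun s => switchFun θ (τ - s) * u s) volume 0 τ :=
  (h.intervalIntegrable (left_mem_Icc.2 h.nonneg) (right_mem_Icc.2 h.nonneg)).continuousOn_mul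
    ((continuous_switchFun θ).comp (continuous_const.sub continuous_id)).continuousOn

lemma intervalIntegrable_abs_switchFun_comp (θ τ : ℝ) :
    IntervalIntegrable (fun s => |switchFun θ (τ - s)|) volume 0 τ :=
  ((continuous_switchFun θ).comp (continuous_const.sub continuous_id)).abs.intervalIntegrable _ _

/-- States that can be steered into the disc in time `τ` satisfy the support inequalities. -/
lemma IsTrajectory.support_le {l : ℝ} (hl : 0 ≤ l) {u : ℝ → ℝ} {x : ℝ → ℝ × ℝ} {x₀ : ℝ × ℝ}
    {τ : ℝ} (h : IsTrajectory u x x₀ τ) (hx : x τ ∈ disc l) (θ : ℝ) :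
    cos θ * (x₀.1 + τ * x₀.2) + sin θ * x₀.2 ≤ l + ∫ s in (0 : ℝ)..τ, |switchFun θ s| := by
  have h1 := h.pairing θ
  have h2 := cos_mul_add_sin_mul_le hl hx θ
  have h3 : 0 ≤ ∫ s in (0 : ℝ)..τ, (|switchFun θ (τ - s)| + switchFun θ (τ - s) * u s) := by
    refine intervalIntegral.integral_nonneg h.nonneg fun s hs => ?_
    have : |switchFun θ (τ - s) * u s| ≤ |switchFun θ (τ - s)| := by
      rw [abs_mul]
      exact mul_le_of_le_one_right (abs_nonneg _) (h.abs_le_one hs)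
    linarith [neg_abs_le (switchFun θ (τ - s) * u s)]
  rw [intervalIntegral.integral_add (intervalIntegrable_abs_switchFun_comp θ τ)
    (intervalIntegrable_switchFun_comp_mul h θ), abs_switchFun_integral_comp] at h3
  linarith

/-- A trajectory from a point of the extremal that is in the disc at the end follows
the extremal. -/
lemma IsTrajectory.rigidity {l : ℝ} (hl : 0 ≤ l) {u : ℝ → ℝ} {x : ℝ → ℝ × ℝ} {θ τ : ℝ}
    (h : IsTrajectory u x (extremal l θ τ) τ) (hx : x τ ∈ disc l) :
    (∀ᵐ t ∂(volume.restrict (Icc 0 τ)), u t = -Real.sign (switchFun θ (τ - t))) ∧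
      ∀ t ∈ Icc 0 τ, x t = extremal l θ (τ - t) := by
  have h1 := h.pairing θ
  have h2 := cos_mul_add_sin_mul_le hl hx θ
  have h0 := extremal_pairing_self l θ h.nonneg
  have hi := (intervalIntegrable_abs_switchFun_comp θ τ).add
    (intervalIntegrable_switchFun_comp_mul h θ)
  have hnn : ∀ s ∈ Icc 0 τ, 0 ≤ |switchFun θ (τ - s)| + switchFun θ (τ - s) * u s := by
    intro s hs
    have : |switchFun θ (τ - s) * u s| ≤ |switchFun θ (τ - s)| := by
      rw [abs_mul]
      exact mul_le_of_le_one_right (abs_nonneg _) (h.abs_le_one hs)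
    linarith [neg_abs_le (switchFun θ (τ - s) * u s)]
  -- The terminal pairing is at most l while the initial state has equality in the support
  -- inequality, so the nonnegative integrand |σ| + σu has integral zero.
  have h3 : ∫ s in (0 : ℝ)..τ, (|switchFun θ (τ - s)| + switchFun θ (τ - s) * u s) = 0 := by
    refine le_antisymm ?_ (intervalIntegral.integral_nonneg h.nonneg hnn)
    rw [intervalIntegral.integral_add (intervalIntegrable_abs_switchFun_comp θ τ)
      (intervalIntegrable_switchFun_comp_mul h θ), abs_switchFun_integral_comp]
    linarith
  have hae : ∀ᵐ t ∂(volume.restrict (Icc 0 τ)), u t = -Real.sign (switchFun θ (τ - t)) := by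
    rw [intervalIntegral.integral_eq_zero_iff_of_le_of_nonneg_ae h.nonneg ?_ hi] at h3
    · rw [Measure.restrict_congr_set Ioc_ae_eq_Icc] at h3
      have h4 : ∀ᵐ t : ℝ, switchFun θ (τ - t) ≠ 0 :=
        (Measure.measurePreserving_sub_left volume τ).quasiMeasurePreserving.ae
          (ae_switchFun_ne_zero θ)
      filter_upwards [h3, ae_restrict_of_ae h4] with t ht ht'
      simp only [Pi.zero_apply] at ht
      rcases lt_or_gt_of_ne ht' with hn | hp
      · rw [Real.sign_of_neg hn]
        rw [abs_of_neg hn] at ht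
        have : switchFun θ (τ - t) * (u t - 1) = 0 := by linarith
        have := (mul_eq_zero.1 this).resolve_left ht'
        linarith
      · rw [Real.sign_of_pos hp]
        rw [abs_of_pos hp] at ht
        have : switchFun θ (τ - t) * (u t + 1) = 0 := by linarith
        have := (mul_eq_zero.1 this).resolve_left ht'
        linarith
    · rw [Filter.EventuallyLE, ae_restrict_iff' measurableSet_Ioc]
      exact Eventually.of_forall fun s hs => hnn s ⟨hs.1.le, hs.2⟩
  exact ⟨hae, h.eqOn_of_ae_eq (isTrajectory_extremal l θ h.nonneg) hae⟩

/-! ### Viability of the disc -/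

/-- Braking with u = -1 until x₂ = 0 does not increase the norm, and the state can then be held at
rest with u = 0. -/
lemma viable_of_nonneg {l : ℝ} (hl : 0 < l) (hl1 : l ≤ 1) {p : ℝ × ℝ} (hp : p ∈ disc l)
    (hp2 : 0 ≤ p.2) {σ : ℝ} (hσ : 0 ≤ σ) :
    ∃ u x, IsTrajectory u x p σ ∧ ∀ t ∈ Icc 0 σ, x t ∈ disc l := by
  have hp' : p.1 ^ 2 + p.2 ^ 2 ≤ l ^ 2 := hp
  have hp1 : p.1 ≤ l := abs_le_of_sq_le_sq' (by nlinarith) hl.le |>.2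
  have hc : p.1 + p.2 ^ 2 / 2 ≤ 1 := by nlinarith
  have hdec : ∀ t, 0 ≤ t → t ≤ p.2 →
      (p.1 + p.2 * t + -1 * t ^ 2 / 2, p.2 + -1 * t) ∈ disc l := by
    intro t ht htp
    refine le_trans (le_of_sub_nonneg ?_) hp'
    -- While braking, c = x₁ + x₂²/2 is conserved, so with q = x₂² the squared norm is c² + (1 - c)q
    -- + q²/4. It increases with q once c ≤ 1, which is where l ≤ 1 is used.
    have e : p.1 ^ 2 + p.2 ^ 2 -
        ((p.1 + p.2 * t + -1 * t ^ 2 / 2) ^ 2 + (p.2 + -1 * t) ^ 2) =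
        (p.2 ^ 2 - (p.2 - t) ^ 2) * ((1 - (p.1 + p.2 ^ 2 / 2)) +
          (p.2 ^ 2 + (p.2 - t) ^ 2) / 4) := by ring
    rw [e]
    refine mul_nonneg (by nlinarith) ?_
    have := sq_nonneg (p.2 - t)
    have := sq_nonneg p.2
    linarith
  have hm : (-1 : ℝ) ∈ Icc (-1 : ℝ) 1 := by norm_num
  have hz : (0 : ℝ) ∈ Icc (-1 : ℝ) 1 := by norm_num
  rcases le_total σ p.2 with h | h
  · exact ⟨_, _, isTrajectory_const p hm hσ, fun t ht => hdec t ht.1 (ht.2.trans h)⟩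
  · have h1 := (isTrajectory_const p hm hp2).concat
      (isTrajectory_const _ hz (sub_nonneg.2 h))
    rw [add_sub_cancel] at h1
    refine ⟨_, _, h1, fun t ht => ?_⟩
    simp only
    split_ifs with htp
    · exact hdec t ht.1 htp
    · simpa using hdec p.2 hp2 le_rfl

/-- From every point of the disc there are trajectories that remain in the disc. -/
lemma viable {l : ℝ} (hl : 0 < l) (hl1 : l ≤ 1) {p : ℝ × ℝ} (hp : p ∈ disc l) {σ : ℝ}
    (hσ : 0 ≤ σ) : ∃ u x, IsTrajectory u x p σ ∧ ∀ t ∈ Icc 0 σ, x t ∈ disc l := by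
  rcases le_total 0 p.2 with h | h
  · exact viable_of_nonneg hl hl1 hp h hσ
  · obtain ⟨u, x, hx, hd⟩ := viable_of_nonneg hl hl1 (p := -p) (by simpa [disc] using hp)
      (by simpa using h) hσ
    have := hx.neg
    rw [neg_neg] at this
    exact ⟨_, _, this, fun t ht => by simpa [disc] using hd t ht⟩

/-- A trajectory that is in the disc at the end can be prolonged within the disc. -/
lemma IsTrajectory.prolong {l : ℝ} (hl : 0 < l) (hl1 : l ≤ 1) {u : ℝ → ℝ} {x : ℝ → ℝ × ℝ}
    {x₀ : ℝ × ℝ} {T : ℝ} (h : IsTrajectory u x x₀ T) (hx : x T ∈ disc l) {τ : ℝ} (hτ : T ≤ τ) :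
    ∃ v y, IsTrajectory v y x₀ τ ∧ (∀ t ∈ Icc 0 T, y t = x t) ∧ y τ ∈ disc l := by
  obtain ⟨v, y, hy, hd⟩ := viable hl hl1 hx (sub_nonneg.2 hτ)
  have h1 := h.concat hy
  rw [add_sub_cancel] at h1
  refine ⟨_, _, h1, fun t ht => if_pos ht.2, ?_⟩
  split_ifs with hc
  · rwa [le_antisymm hc hτ]
  · exact hd _ (right_mem_Icc.2 (sub_nonneg.2 hτ))

/-! ### Extremals are optimal -/

lemma extremal_of_sign_eq {l θ τ ε : ℝ} (hτ : 0 ≤ τ)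
    (h : ∀ s ∈ Ioo 0 τ, Real.sign (switchFun θ s) = ε) :
    extremal l θ τ = (l * (cos θ - τ * sin θ) - ε * τ ^ 2 / 2, l * sin θ + ε * τ) := by
  have h2 : ∀ t ∈ Icc 0 τ, extremalSnd l θ t = l * sin θ + ε * t := by
    intro t ht
    have : ∫ s in (0 : ℝ)..t, Real.sign (switchFun θ s) = ∫ _ in (0 : ℝ)..t, ε := by
      refine intervalIntegral.integral_congr_ae ?_
      have : ∀ᵐ s : ℝ, s ≠ t := by simp [ae_iff]
      filter_upwards [this] with s hst hs
      rw [uIoc_of_le ht.1] at hs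
      exact h s ⟨hs.1, (lt_of_le_of_ne hs.2 hst).trans_le ht.2⟩
    rw [extremalSnd, this]
    simp [mul_comm]
  ext
  · simp only [extremal]
    have : ∫ s in (0 : ℝ)..τ, extremalSnd l θ s = ∫ s in (0 : ℝ)..τ, (l * sin θ + ε * s) := by
      refine intervalIntegral.integral_congr fun s hs => h2 s ?_
      rwa [uIcc_of_le hτ] at hs
    rw [this, intervalIntegral.integral_add intervalIntegrable_const
      (by apply Continuous.intervalIntegrable; fun_prop), intervalIntegral.integral_const_mul ε]
    simp
    ring
  · exact h2 τ (right_mem_Icc.2 hτ)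

/-- Close to the target the extremal control is constant. When sin θ = 0 its sign comes from cos θ,
so only the weak inequality 0 ≤ ε sin θ is available. -/
lemma exists_sign_switchFun_eq (θ : ℝ) : ∃ ε δ : ℝ, 0 < δ ∧ ε ^ 2 = 1 ∧ 0 ≤ ε * sin θ ∧
    ∀ s ∈ Ioo 0 δ, Real.sign (switchFun θ s) = ε := by
  have hpos : ∀ φ, (0 < sin φ ∨ sin φ = 0 ∧ 0 < cos φ) →
      ∃ δ : ℝ, 0 < δ ∧ ∀ s ∈ Ioo 0 δ, 0 < switchFun φ s := by
    rintro φ (h | ⟨h, h'⟩)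
    · refine ⟨sin φ, h, fun s hs => ?_⟩
      simp only [switchFun]
      nlinarith [neg_one_le_cos φ, hs.1, hs.2]
    · refine ⟨1, one_pos, fun s hs => ?_⟩
      simp only [switchFun, h]
      nlinarith [hs.1]
  have hcase : (0 < sin θ ∨ sin θ = 0 ∧ 0 < cos θ) ∨ (sin θ < 0 ∨ sin θ = 0 ∧ cos θ < 0) := by
    rcases lt_trichotomy (sin θ) 0 with h | h | h
    · exact .inr (.inl h)
    · have : cos θ ≠ 0 := fun hc => by simpa [h, hc] using sin_sq_add_cos_sq θ
      rcases lt_or_gt_of_ne this with hc | hc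
      · exact .inr (.inr ⟨h, hc⟩)
      · exact .inl (.inr ⟨h, hc⟩)
    · exact .inl (.inl h)
  rcases hcase with h | h
  · obtain ⟨δ, hδ, hs⟩ := hpos θ h
    refine ⟨1, δ, hδ, by norm_num, ?_, fun s hs' => Real.sign_of_pos (hs s hs')⟩
    rcases h with h | ⟨h, _⟩ <;> simp [h, le_of_lt]
  · obtain ⟨δ, hδ, hs⟩ := hpos (θ + π) (by simpa using h)
    refine ⟨-1, δ, hδ, by norm_num, ?_, fun s hs' => Real.sign_of_neg ?_⟩
    · rcases h with h | ⟨h, _⟩ <;> simp [h, le_of_lt]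
    · have := hs s hs'
      rw [switchFun_add_pi] at this
      linarith

/-- If the extremal were in the disc at τ, a viable trajectory from there would be the extremal by
rigidity. The extremal would then be in the disc at small retrograde times as well, where an
explicit expansion shows that it is not. -/
lemma extremal_mem_exterior {l : ℝ} (hl : 0 < l) (hl1 : l ≤ 1) (θ : ℝ) {τ : ℝ} (hτ : 0 < τ) :
    extremal l θ τ ∈ exterior l := by
  by_contra hcon
  rw [not_mem_exterior_iff] at hcon
  obtain ⟨u, x, hx, hd⟩ := viable hl hl1 hcon hτ.le
  have hrig := (hx.rigidity hl.le (hd τ (right_mem_Icc.2 hτ.le))).2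
  obtain ⟨ε, δ, hδ, hε, hεs, hsign⟩ := exists_sign_switchFun_eq θ
  set s := min δ τ with hs
  have hs0 : 0 < s := lt_min hδ hτ
  have hmem : extremal l θ s ∈ disc l := by
    have ht : τ - s ∈ Icc 0 τ := ⟨sub_nonneg.2 (min_le_right _ _), by linarith⟩
    have := hd _ ht
    rwa [hrig _ ht, sub_sub_cancel] at this
  rw [extremal_of_sign_eq hs0.le (ε := ε)
    (fun r hr => hsign r ⟨hr.1, hr.2.trans_le (min_le_left _ _)⟩)] at hmem
  simp only [disc, mem_ofPred_eq] at hmem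
  have hc : 0 ≤ 1 - l * (ε * cos θ) := by
    have h1 : (ε * cos θ) ^ 2 ≤ 1 := by
      rw [mul_pow, hε, one_mul]; nlinarith [sin_sq_add_cos_sq θ, sq_nonneg (sin θ)]
    have h2 := abs_le_one_iff_mul_self_le_one.2 (by nlinarith : (ε * cos θ) * (ε * cos θ) ≤ 1)
    nlinarith [(abs_le.1 h2).2]
  -- Every term on the right is nonnegative and s⁴/4 is positive; this last term covers the
  -- tangential case sin θ = 0 even when l = 1.
  have e : (l * (cos θ - s * sin θ) - ε * s ^ 2 / 2) ^ 2 + (l * sin θ + ε * s) ^ 2 - l ^ 2 =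
      2 * l * s * (ε * sin θ) * (1 - l * (ε * cos θ)) + s ^ 2 * (1 - l * (ε * cos θ)) +
        l ^ 2 * s ^ 2 * sin θ ^ 2 + s ^ 4 / 4 + l * s ^ 3 * (ε * sin θ) := by
    linear_combination (s ^ 4 / 4 + s ^ 2 + 2 * l ^ 2 * s * cos θ * sin θ) * hε +
      l ^ 2 * sin_sq_add_cos_sq θ
  have h3 : 0 ≤ 2 * l * s * (ε * sin θ) * (1 - l * (ε * cos θ)) := by positivity
  have h4 : 0 ≤ l * s ^ 3 * (ε * sin θ) := by positivity
  have h5 : 0 < s ^ 4 / 4 := by positivity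
  have h6 : 0 ≤ s ^ 2 * (1 - l * (ε * cos θ)) := by positivity
  have h7 : 0 ≤ l ^ 2 * s ^ 2 * sin θ ^ 2 := by positivity
  linarith

lemma circlePoint_mem_circleTarget (l θ : ℝ) : circlePoint l θ ∈ circleTarget l := by
  simp only [circlePoint, circleTarget, mem_ofPred_eq]
  linear_combination l ^ 2 * sin_sq_add_cos_sq θ

lemma reachTimes_nonneg {l : ℝ} {p : ℝ × ℝ} {T : ℝ} (h : T ∈ reachTimes l p) : 0 ≤ T := by
  obtain ⟨u, x, hx, -⟩ := h
  exact hx.nonneg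

/-- A trajectory from a point of the extremal cannot enter the disc early. -/
lemma le_of_isTrajectory_extremal {l : ℝ} (hl : 0 < l) (hl1 : l ≤ 1) {θ τ : ℝ} {u : ℝ → ℝ}
    {x : ℝ → ℝ × ℝ} {T : ℝ} (h : IsTrajectory u x (extremal l θ τ) T) (hx : x T ∈ disc l) :
    τ ≤ T := by
  by_contra! hlt
  obtain ⟨v, y, hy, hyx, hyd⟩ := h.prolong hl hl1 hx hlt.le
  have hT : T ∈ Icc 0 T := right_mem_Icc.2 h.nonneg
  have := (hy.rigidity hl.le hyd).2 T ⟨h.nonneg, hlt.le⟩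
  rw [hyx T hT] at this
  rw [this] at hx
  exact not_mem_exterior_iff.2 hx (extremal_mem_exterior hl hl1 θ (sub_pos.2 hlt))

lemma isLeast_extremal {l : ℝ} (hl : 0 < l) (hl1 : l ≤ 1) (θ : ℝ) {τ : ℝ} (hτ : 0 ≤ τ) :
    IsLeast (reachTimes l (extremal l θ τ)) τ := by
  refine ⟨⟨_, _, isTrajectory_extremal l θ hτ, ?_⟩, ?_⟩
  · simp only [sub_self, extremal_zero]
    exact circlePoint_mem_circleTarget l θ
  · rintro T ⟨u, x, hx, hxT⟩
    exact le_of_isTrajectory_extremal hl hl1 hx (mem_disc_of_mem_circleTarget hxT)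

lemma value_extremal {l : ℝ} (hl : 0 < l) (hl1 : l ≤ 1) (θ : ℝ) {τ : ℝ} (hτ : 0 ≤ τ) :
    value l (extremal l θ τ) = τ := (isLeast_extremal hl hl1 θ hτ).csInf_eq

/-- The extremals cover every state at most once. -/
lemma extremal_injective {l : ℝ} (hl : 0 < l) (hl1 : l ≤ 1) {θ θ' τ τ' : ℝ} (hτ : 0 ≤ τ)
    (hτ' : 0 ≤ τ') (h : extremal l θ τ = extremal l θ' τ') :
    τ = τ' ∧ cos θ = cos θ' ∧ sin θ = sin θ' := by
  have ht : τ = τ' := by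
    rw [← value_extremal hl hl1 θ hτ, h, value_extremal hl hl1 θ' hτ']
  subst ht
  -- Both extremals start from the same state and last equally long, so rigidity identifies their
  -- end points on the circle, and these determine the angle.
  have h1 := isTrajectory_extremal l θ' hτ
  rw [← h] at h1
  have h2 := (h1.rigidity hl.le (by
    simp only [sub_self, extremal_zero]
    exact mem_disc_of_mem_circleTarget (circlePoint_mem_circleTarget l θ'))).2 τ
      (right_mem_Icc.2 hτ)
  simp only [sub_self, extremal_zero, Prod.mk.injEq] at h2
  exact ⟨rfl, (mul_left_cancel₀ hl.ne' h2.1).symm, (mul_left_cancel₀ hl.ne' h2.2).symm⟩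

/-! ### The extremals cover the exterior -/

/-- Violation at time `τ` of the support inequality in the direction of angle `θ`. -/
noncomputable def supportGap (l τ θ : ℝ) (p : ℝ × ℝ) : ℝ :=
  cos θ * (p.1 + τ * p.2) + sin θ * p.2 - l - ∫ s in (0 : ℝ)..τ, |switchFun θ s|

lemma continuous_integral_abs_switchFun :
    Continuous fun q : ℝ × ℝ => ∫ s in (0 : ℝ)..q.1, |switchFun q.2 s| := by
  refine intervalIntegral.continuous_parametric_intervalIntegral_of_continuous
    (f := fun (q : ℝ × ℝ) s => |switchFun q.2 s|) ?_ continuous_fst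
  simp only [Function.uncurry_def, switchFun]
  fun_prop

lemma continuous_supportGap (l : ℝ) (p : ℝ × ℝ) :
    Continuous fun q : ℝ × ℝ => supportGap l q.1 q.2 p := by
  have := continuous_integral_abs_switchFun
  unfold supportGap
  fun_prop

lemma supportGap_periodic (l τ : ℝ) (p : ℝ × ℝ) :
    Function.Periodic (fun θ => supportGap l τ θ p) (2 * π) := by
  intro θ
  simp [supportGap, switchFun]

lemma abs_switchFun_sub_le (a b s : ℝ) : |switchFun a s - switchFun b s| ≤ (1 + |s|) * |a - b| := by
  have h1 : |sin a - sin b| ≤ |a - b| := by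
    simpa [Real.dist_eq] using Real.lipschitzWith_sin.dist_le_mul a b
  have h2 : |cos a - cos b| ≤ |a - b| := by
    simpa [Real.dist_eq] using Real.lipschitzWith_cos.dist_le_mul a b
  calc |switchFun a s - switchFun b s| = |(sin a - sin b) + s * (cos a - cos b)| := by
        simp only [switchFun]; ring_nf
    _ ≤ |sin a - sin b| + |s| * |cos a - cos b| := by
        rw [← abs_mul]; exact abs_add_le _ _
    _ ≤ |a - b| + |s| * |a - b| := by gcongr
    _ = (1 + |s|) * |a - b| := by ring

lemma hasDerivAt_switchFun_angle (θ s : ℝ) :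
    HasDerivAt (fun θ => switchFun θ s) (switchFun (θ + π / 2) s) θ := by
  have e : switchFun (θ + π / 2) s = cos θ + s * -sin θ := by
    rw [switchFun, sin_add_pi_div_two, cos_add_pi_div_two]
  rw [e]
  exact (hasDerivAt_sin θ).add ((hasDerivAt_cos θ).const_mul s)

lemma HasDerivAt.abs_of_ne_zero {f : ℝ → ℝ} {f' x : ℝ} (h : HasDerivAt f f' x) (hx : f x ≠ 0) :
    HasDerivAt (fun y => |f y|) (f' * Real.sign (f x)) x := by
  rcases lt_or_gt_of_ne hx with hn | hp
  · rw [Real.sign_of_neg hn]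
    have := (hasDerivAt_abs_neg hn).comp x h
    simpa [Function.comp_def] using this
  · rw [Real.sign_of_pos hp]
    have := (hasDerivAt_abs_pos hp).comp x h
    simpa [Function.comp_def] using this

/-- Differentiation under the integral: the integrand is Lipschitz in the angle and fails to be
differentiable only where σ vanishes. Differentiating σ in θ rotates the angle by π/2, so the result
is the integral in `extremal_pairing` for the direction orthogonal to n_θ. -/
lemma hasDerivAt_integral_abs_switchFun (θ τ : ℝ) :
    HasDerivAt (fun θ => ∫ s in (0 : ℝ)..τ, |switchFun θ s|)
      (∫ s in (0 : ℝ)..τ, switchFun (θ + π / 2) s * Real.sign (switchFun θ s)) θ := by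
  refine (intervalIntegral.hasDerivAt_integral_of_dominated_loc_of_lip (s := univ)
    (bound := fun s => 1 + |s|) univ_mem ?_ ?_ ?_ ?_ ?_ ?_).2
  · exact Eventually.of_forall fun φ => (continuous_switchFun φ).abs.aestronglyMeasurable
  · exact (continuous_switchFun θ).abs.intervalIntegrable _ _
  · exact ((continuous_switchFun _).measurable.mul
      (measurable_sign_switchFun θ)).aestronglyMeasurable
  · refine Eventually.of_forall fun s _ => LipschitzOnWith.of_dist_le_mul fun a _ b _ => ?_
    have h0 : (0 : ℝ) ≤ 1 + |s| := by positivity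
    rw [Real.dist_eq, Real.dist_eq, Real.coe_nnabs, abs_of_nonneg h0]
    exact (abs_abs_sub_abs_le_abs_sub _ _).trans (abs_switchFun_sub_le a b s)
  · exact (by fun_prop : Continuous fun s : ℝ => 1 + |s|).intervalIntegrable _ _
  · filter_upwards [ae_switchFun_ne_zero θ] with s hs _
    exact (hasDerivAt_switchFun_angle θ s).abs_of_ne_zero hs

lemma exists_polar (p : ℝ × ℝ) : ∃ φ, cos φ * p.1 + sin φ * p.2 = √(p.1 ^ 2 + p.2 ^ 2) := by
  have hn : ‖(⟨p.1, p.2⟩ : ℂ)‖ = √(p.1 ^ 2 + p.2 ^ 2) := by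
    rw [Complex.norm_def, Complex.normSq_mk]; congr 1; ring
  have h1 := Complex.norm_mul_cos_arg (⟨p.1, p.2⟩ : ℂ)
  have h2 := Complex.norm_mul_sin_arg (⟨p.1, p.2⟩ : ℂ)
  refine ⟨Complex.arg ⟨p.1, p.2⟩, ?_⟩
  rw [hn] at h1 h2
  have hs := sin_sq_add_cos_sq (Complex.arg ⟨p.1, p.2⟩)
  linear_combination √(p.1 ^ 2 + p.2 ^ 2) * hs - cos (Complex.arg ⟨p.1, p.2⟩) * h1 -
    sin (Complex.arg ⟨p.1, p.2⟩) * h2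

/-- An exterior state satisfying all support inequalities at time `v` lies on an extremal. -/
lemma exists_extremal_of_supportGap_nonpos {l : ℝ} {p : ℝ × ℝ}
    (hp : p ∈ exterior l) {v : ℝ} (hv : 0 ≤ v) (h : ∀ θ, supportGap l v θ p ≤ 0) :
    ∃ θ τ, 0 < τ ∧ τ ≤ v ∧ p = extremal l θ τ := by
  have hcont := continuous_supportGap l p
  set g : ℝ → ℝ := fun τ => sSup ((fun θ => supportGap l τ θ p) '' Icc 0 (2 * π)) with hg
  have hgc : Continuous g := isCompact_Icc.continuous_sSup hcont
  have hmax : ∀ τ, ∃ θ, g τ = supportGap l τ θ p ∧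
      ∀ φ, supportGap l τ φ p ≤ supportGap l τ θ p := by
    intro τ
    obtain ⟨θ, -, h1, h2⟩ := isCompact_Icc.exists_sSup_image_eq_and_ge
      (nonempty_Icc.2 (by positivity : (0 : ℝ) ≤ 2 * π))
      (hcont.comp (Continuous.prodMk_right τ)).continuousOn
    refine ⟨θ, h1, fun φ => ?_⟩
    obtain ⟨ψ, hψ, e⟩ := (supportGap_periodic l τ p).exists_mem_Ico₀ (by positivity) φ
    rw [e]
    exact h2 ψ (Ico_subset_Icc_self hψ)
  -- At time 0 the gap in the polar direction of p is |p| - l.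
  have hg0 : 0 < g 0 := by
    obtain ⟨θ, h1, h2⟩ := hmax 0
    obtain ⟨φ, hφ⟩ := exists_polar p
    rw [h1]
    refine lt_of_lt_of_le ?_ (h2 φ)
    simp only [supportGap, zero_mul, add_zero, intervalIntegral.integral_same, sub_zero, hφ]
    exact sub_pos.2 (Real.lt_sqrt_of_sq_lt hp)
  have hgv : g v ≤ 0 := by
    obtain ⟨θ, h1, -⟩ := hmax v
    rw [h1]; exact h θ
  obtain ⟨τ, hτ, hτ0⟩ := intermediate_value_Icc' hv hgc.continuousOn ⟨hgv, hg0.le⟩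
  have hτpos : 0 < τ := lt_of_le_of_ne hτ.1 fun e => by rw [← e] at hτ0; linarith
  obtain ⟨θ, h1, h2⟩ := hmax τ
  rw [hτ0] at h1
  refine ⟨θ, τ, hτpos, hτ.2, ?_⟩
  have hd : HasDerivAt (fun φ => supportGap l τ φ p)
      (-sin θ * (p.1 + τ * p.2) + cos θ * p.2 - 0 -
        ∫ s in (0 : ℝ)..τ, switchFun (θ + π / 2) s * Real.sign (switchFun θ s)) θ :=
    ((((hasDerivAt_cos θ).mul_const _).add ((hasDerivAt_sin θ).mul_const _)).sub
      (hasDerivAt_const θ l)).sub (hasDerivAt_integral_abs_switchFun θ τ)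
  -- Stationarity in θ matches p with the extremal in the direction orthogonal to n_θ; the vanishing
  -- of the gap matches them along n_θ.
  have hz := IsLocalMax.hasDerivAt_eq_zero (Eventually.of_forall h2) hd
  have e1 := extremal_pairing_self l θ hτpos.le
  have e2 := extremal_pairing l θ (θ + π / 2) hτpos.le
  rw [add_sub_cancel_left, cos_pi_div_two, cos_add_pi_div_two, sin_add_pi_div_two] at e2
  simp only [supportGap] at h1
  set z := extremal l θ τ
  have hs := sin_sq_add_cos_sq θ
  -- The sheared difference of p and the extremal is orthogonal to both vectors of an orthonormal
  -- frame, hence zero.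
  have d1 : cos θ * ((p.1 - z.1) + τ * (p.2 - z.2)) + sin θ * (p.2 - z.2) = 0 := by
    linarith
  have d2 : -sin θ * ((p.1 - z.1) + τ * (p.2 - z.2)) + cos θ * (p.2 - z.2) = 0 := by
    linarith
  have d3 : p.2 - z.2 = 0 := by
    linear_combination sin θ * d1 + cos θ * d2 - (p.2 - z.2) * hs
  have d4 : p.1 - z.1 = 0 := by
    linear_combination cos θ * d1 - sin θ * d2 - (p.1 - z.1 + τ * (p.2 - z.2)) * hs - τ * d3
  ext
  · linarith
  · linarith

/-- States from which the origin can be reached. -/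
def Steerable (p : ℝ × ℝ) : Prop := ∃ T u x, IsTrajectory u x p T ∧ x T = 0

lemma Steerable.of_neg {p : ℝ × ℝ} (h : Steerable (-p)) : Steerable p := by
  obtain ⟨T, u, x, hx, h0⟩ := h
  have := hx.neg
  rw [neg_neg] at this
  exact ⟨T, _, _, this, by simp [h0]⟩

lemma Steerable.of_isTrajectory {p : ℝ × ℝ} {u : ℝ → ℝ} {x : ℝ → ℝ × ℝ} {T : ℝ}
    (h : IsTrajectory u x p T) (hs : Steerable (x T)) : Steerable p := by
  obtain ⟨S, v, y, hy, h0⟩ := hs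
  refine ⟨T + S, _, _, h.concat hy, ?_⟩
  split_ifs with hc
  · have hS : S = 0 := by linarith [hy.nonneg]
    rw [hS, hy.initial] at h0
    rw [hS, add_zero, h0]
  · rwa [add_sub_cancel_left]

/-- From rest at distance d, accelerate for time √d and brake for time √d. -/
lemma steerable_of_snd_eq_zero (p : ℝ × ℝ) (hp : p.2 = 0) : Steerable p := by
  have key : ∀ p : ℝ × ℝ, p.2 = 0 → p.1 ≤ 0 → Steerable p := by
    intro p h2 h1
    have hsq : √(-p.1) ^ 2 = -p.1 := Real.sq_sqrt (by linarith)
    refine Steerable.of_isTrajectory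
      (isTrajectory_const p (c := 1) (by norm_num) (Real.sqrt_nonneg (-p.1))) ?_
    refine ⟨√(-p.1), _, _, isTrajectory_const _ (c := -1) (by norm_num) (Real.sqrt_nonneg _), ?_⟩
    ext
    · simp only [h2, Prod.fst_zero]
      linear_combination hsq
    · simp [h2]
  rcases le_total p.1 0 with h | h
  · exact key p hp h
  · exact Steerable.of_neg (key (-p) (by simp [hp]) (by simpa using h))

lemma steerable (p : ℝ × ℝ) : Steerable p := by
  have key : ∀ p : ℝ × ℝ, 0 ≤ p.2 → Steerable p := fun p h =>
    Steerable.of_isTrajectory (isTrajectory_const p (c := -1) (by norm_num) h)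
      (steerable_of_snd_eq_zero _ (by simp))
  rcases le_total 0 p.2 with h | h
  · exact key p h
  · exact Steerable.of_neg (key (-p) (by simpa using h))

/-- Every exterior state lies on an extremal. -/
lemma exists_extremal {l : ℝ} (hl : 0 < l) {p : ℝ × ℝ} (hp : p ∈ exterior l) :
    ∃ θ τ, 0 < τ ∧ p = extremal l θ τ := by
  obtain ⟨T, u, x, hx, h0⟩ := steerable p
  obtain ⟨θ, τ, hτ, -, h⟩ := exists_extremal_of_supportGap_nonpos hp hx.nonneg (fun θ => by
    have := hx.support_le hl.le (by rw [h0]; simp [disc]; positivity) θ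
    simp only [supportGap]; linarith)
  exact ⟨θ, τ, hτ, h⟩

lemma value_le_of_mem_disc {l : ℝ} (hl : 0 < l) (hl1 : l ≤ 1) {p : ℝ × ℝ} (hp : p ∈ exterior l)
    {u : ℝ → ℝ} {x : ℝ → ℝ × ℝ} {T : ℝ} (h : IsTrajectory u x p T) (hx : x T ∈ disc l) :
    value l p ≤ T := by
  obtain ⟨θ, τ, hτ, rfl⟩ := exists_extremal hl hp
  rw [value_extremal hl hl1 θ hτ.le]
  exact le_of_isTrajectory_extremal hl hl1 h hx

lemma value_le_of_supportGap_nonpos {l : ℝ} (hl : 0 < l) (hl1 : l ≤ 1) {p : ℝ × ℝ}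
    (hp : p ∈ exterior l) {v : ℝ} (hv : 0 ≤ v) (h : ∀ θ, supportGap l v θ p ≤ 0) :
    value l p ≤ v := by
  obtain ⟨θ, τ, hτ, hτv, rfl⟩ := exists_extremal_of_supportGap_nonpos hp hv h
  rwa [value_extremal hl hl1 θ hτ.le]

/-- An optimal trajectory prolonged inside the disc until v gives the inequalities at time v. With
`value_le_of_supportGap_nonpos` this describes exterior sublevel sets of the value by closed
conditions. -/
lemma supportGap_nonpos_of_value_le {l : ℝ} (hl : 0 < l) (hl1 : l ≤ 1) {p : ℝ × ℝ}
    (hp : p ∈ exterior l) {v : ℝ} (h : value l p ≤ v) (θ : ℝ) : supportGap l v θ p ≤ 0 := by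
  obtain ⟨φ, τ, hτ, rfl⟩ := exists_extremal hl hp
  rw [value_extremal hl hl1 φ hτ.le] at h
  obtain ⟨u, x, hx, -, hd⟩ := (isTrajectory_extremal l φ hτ.le).prolong hl hl1
    (by simp only [sub_self, extremal_zero]
        exact mem_disc_of_mem_circleTarget (circlePoint_mem_circleTarget l φ)) h
  have := hx.support_le hl.le hd θ
  simp only [supportGap]; linarith

lemma isLeast_value {l : ℝ} (hl : 0 < l) (hl1 : l ≤ 1) {p : ℝ × ℝ} (hp : p ∈ exterior l) :
    0 < value l p ∧ IsLeast (reachTimes l p) (value l p) := by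
  obtain ⟨φ, τ, hτ, rfl⟩ := exists_extremal hl hp
  rw [value_extremal hl hl1 φ hτ.le]
  exact ⟨hτ, isLeast_extremal hl hl1 φ hτ.le⟩

lemma value_of_mem_circleTarget {l : ℝ} {p : ℝ × ℝ} (hp : p ∈ circleTarget l) : value l p = 0 := by
  refine IsLeast.csInf_eq ⟨⟨_, _, isTrajectory_const p (c := 0) (by norm_num) le_rfl, ?_⟩,
    fun T hT => reachTimes_nonneg hT⟩
  simpa using hp

/-! ### The gradient of the value function -/

/-- Along the graph of the candidate linearization lowered by δ‖x - x₀‖, φ equals cδ‖x - x₀‖ to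
first order, so its sign near x₀ is that of δ. -/
lemma isLittleO_comp_tilted {φ : ℝ × ℝ × ℝ → ℝ} {x₀ : ℝ × ℝ} {τ c : ℝ} {L : ℝ × ℝ →L[ℝ] ℝ}
    (hφ : HasFDerivAt φ (c • (L.comp (ContinuousLinearMap.snd ℝ ℝ (ℝ × ℝ)) -
      ContinuousLinearMap.fst ℝ ℝ (ℝ × ℝ))) (τ, x₀)) (h0 : φ (τ, x₀) = 0) (δ : ℝ) :
    (fun x => φ (τ + L (x - x₀) - δ * ‖x - x₀‖, x) - c * δ * ‖x - x₀‖)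
      =o[𝓝 x₀] fun x => x - x₀ := by
  have hq : Tendsto (fun x : ℝ × ℝ => (τ + L (x - x₀) - δ * ‖x - x₀‖, x)) (𝓝 x₀)
      (𝓝 (τ, x₀)) := by
    have : Continuous fun x : ℝ × ℝ => (τ + L (x - x₀) - δ * ‖x - x₀‖, x) := by fun_prop
    simpa using this.tendsto x₀
  have h1 := (hφ.isLittleO.comp_tendsto hq)
  have h2 : (fun x : ℝ × ℝ => (τ + L (x - x₀) - δ * ‖x - x₀‖, x) - (τ, x₀)) =O[𝓝 x₀]
      fun x => x - x₀ := by
    refine Asymptotics.IsBigO.prod_left ?_ (Asymptotics.isBigO_refl _ _)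
    have e : (fun x : ℝ × ℝ => (τ + L (x - x₀) - δ * ‖x - x₀‖, x).1 - (τ, x₀).1) =
        fun x => L (x - x₀) - δ * ‖x - x₀‖ := by
      ext x; simp; ring
    rw [e]
    exact (L.isBigO_sub _ _).sub ((Asymptotics.isBigO_refl _ _).norm_left.const_mul_left δ)
  refine (h1.trans_isBigO h2).congr_left fun x => ?_
  simp [h0]
  ring

/-- A function squeezed between two implicitly defined functions with the same differential at a
point is differentiable there. -/
lemma hasFDerivAt_of_squeeze {V : ℝ × ℝ → ℝ} {φ ψ : ℝ × ℝ × ℝ → ℝ} {x₀ : ℝ × ℝ} {τ c d : ℝ}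
    (hc : 0 < c) (hd : 0 < d) {L : ℝ × ℝ →L[ℝ] ℝ}
    (hφ : HasFDerivAt φ (c • (L.comp (ContinuousLinearMap.snd ℝ ℝ (ℝ × ℝ)) -
      ContinuousLinearMap.fst ℝ ℝ (ℝ × ℝ))) (τ, x₀)) (hφ0 : φ (τ, x₀) = 0)
    (hψ : HasFDerivAt ψ (d • (L.comp (ContinuousLinearMap.snd ℝ ℝ (ℝ × ℝ)) -
      ContinuousLinearMap.fst ℝ ℝ (ℝ × ℝ))) (τ, x₀)) (hψ0 : ψ (τ, x₀) = 0)
    (h1 : ∀ᶠ q in 𝓝 (τ, x₀), 0 < φ q → q.1 ≤ V q.2)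
    (h2 : ∀ᶠ q in 𝓝 (τ, x₀), ψ q < 0 → V q.2 ≤ q.1) (hV : V x₀ = τ) :
    HasFDerivAt V L x₀ := by
  rw [hasFDerivAt_iff_isLittleO, Asymptotics.isLittleO_iff]
  intro ε hε
  have hq : ∀ δ : ℝ, Tendsto (fun x : ℝ × ℝ => (τ + L (x - x₀) - δ * ‖x - x₀‖, x)) (𝓝 x₀)
      (𝓝 (τ, x₀)) := by
    intro δ
    have : Continuous fun x : ℝ × ℝ => (τ + L (x - x₀) - δ * ‖x - x₀‖, x) := by fun_prop
    simpa using this.tendsto x₀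
  -- The graph lowered by ε‖x - x₀‖ makes φ positive and bounds V from below; the graph raised by it
  -- makes ψ negative and bounds V from above.
  have e1 := Asymptotics.isLittleO_iff.1 (isLittleO_comp_tilted hφ hφ0 ε)
    (by positivity : 0 < c * ε / 2)
  have e2 := Asymptotics.isLittleO_iff.1 (isLittleO_comp_tilted hψ hψ0 (-ε))
    (by positivity : 0 < d * ε / 2)
  filter_upwards [e1, e2, (hq ε).eventually h1, (hq (-ε)).eventually h2] with x a1 a2 a3 a4
  rcases eq_or_ne x x₀ with rfl | hx
  · simp
  have hn : 0 < ‖x - x₀‖ := norm_pos_iff.2 (sub_ne_zero.2 hx)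
  rw [Real.norm_eq_abs, abs_le] at a1 a2
  have b1 := a3 (by nlinarith [a1.1, mul_pos (mul_pos hc hε) hn])
  have b2 := a4 (by nlinarith [a2.2, mul_pos (mul_pos hd hε) hn])
  rw [Real.norm_eq_abs, abs_le, hV]
  constructor <;> linarith

/-- Conservation of the Hamiltonian, up to the normalizing factor: x₂ has derivative sign σ and |σ|
has derivative cos θ sign σ almost everywhere, so the left side is constant. -/
lemma cos_mul_extremalSnd_sub (l θ τ : ℝ) :
    cos θ * extremalSnd l θ τ - |switchFun θ τ| = l * sin θ * cos θ - |sin θ| := by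
  have hac : AbsolutelyContinuousOnInterval (fun s => |switchFun θ s|) 0 τ := by
    refine LipschitzOnWith.absolutelyContinuousOnInterval (K := ‖cos θ‖₊) ?_
    refine LipschitzOnWith.of_dist_le_mul fun a _ b _ => ?_
    rw [Real.dist_eq, Real.dist_eq, coe_nnnorm, Real.norm_eq_abs, ← abs_mul]
    refine (abs_abs_sub_abs_le_abs_sub _ _).trans (le_of_eq ?_)
    simp only [switchFun]; ring_nf
  have h1 : ∫ s in (0 : ℝ)..τ, deriv (fun s => |switchFun θ s|) s =
      ∫ s in (0 : ℝ)..τ, cos θ * Real.sign (switchFun θ s) := by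
    refine intervalIntegral.integral_congr_ae ?_
    filter_upwards [ae_switchFun_ne_zero θ] with s hs _
    have : HasDerivAt (switchFun θ) (cos θ) s := by
      have e := ((hasDerivAt_id s).mul_const (cos θ)).const_add (sin θ)
      rw [one_mul] at e
      exact e
    exact (this.abs_of_ne_zero hs).deriv
  rw [hac.integral_deriv_eq_sub, intervalIntegral.integral_const_mul] at h1
  have h2 : switchFun θ 0 = sin θ := by simp [switchFun]
  rw [h2] at h1
  rw [extremalSnd]
  linear_combination -h1

lemma isOpen_exterior (l : ℝ) : IsOpen (exterior l) :=
  isOpen_lt (by fun_prop) (by fun_prop)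

/-- For sin θ ≠ 0 one has |cos θ| < 1, so l |sin θ cos θ| < |sin θ| even when l = 1. -/
lemma costate_denominator_pos {l : ℝ} (hl : 0 < l) (hl1 : l ≤ 1) {θ : ℝ} (hθ : sin θ ≠ 0) :
    0 < |sin θ| - l * sin θ * cos θ := by
  have h1 : |cos θ| < 1 := by
    rw [← sq_lt_one_iff_abs_lt_one]
    nlinarith [sin_sq_add_cos_sq θ, sq_pos_of_ne_zero hθ]
  have h2 : l * sin θ * cos θ ≤ l * |sin θ| * |cos θ| := by
    refine (le_abs_self _).trans (le_of_eq ?_)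
    rw [abs_mul, abs_mul, abs_of_pos hl]
  have h3 : 0 < |sin θ| := abs_pos.2 hθ
  have h4 : l * |sin θ| * |cos θ| < |sin θ| := by
    have := mul_lt_mul_of_pos_left h1 (mul_pos hl h3)
    nlinarith
  linarith

lemma continuousAt_sign {r : ℝ} (hr : r ≠ 0) : ContinuousAt Real.sign r := by
  rcases lt_or_gt_of_ne hr with h | h
  · refine (continuousAt_const (y := (-1 : ℝ))).congr ?_
    filter_upwards [Iio_mem_nhds h] with s hs
    exact (Real.sign_of_neg hs).symm
  · refine (continuousAt_const (y := (1 : ℝ))).congr ?_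
    filter_upwards [Ioi_mem_nhds h] with s hs
    exact (Real.sign_of_pos hs).symm

lemma hasFDerivAt_supportGap (l θ : ℝ) {τ : ℝ} (p : ℝ × ℝ) :
    HasFDerivAt (fun q : ℝ × ℝ × ℝ => supportGap l q.1 θ q.2)
      ((cos θ * p.2 - |switchFun θ τ|) • ContinuousLinearMap.fst ℝ ℝ (ℝ × ℝ) +
        ((cos θ) • ContinuousLinearMap.fst ℝ ℝ ℝ +
          (switchFun θ τ) • ContinuousLinearMap.snd ℝ ℝ ℝ).comp
          (ContinuousLinearMap.snd ℝ ℝ (ℝ × ℝ))) (τ, p) := by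
  have hT : HasFDerivAt (𝕜 := ℝ) (fun q : ℝ × ℝ × ℝ => q.1) _ (τ, p) := hasFDerivAt_fst
  have hX := (hasFDerivAt_snd : HasFDerivAt (𝕜 := ℝ) (fun q : ℝ × ℝ × ℝ => q.2) _ (τ, p))
  have h1 := hX.fst
  have h2 := hX.snd
  have hi : HasDerivAt (fun T => ∫ s in (0 : ℝ)..T, |switchFun θ s|) |switchFun θ τ| τ :=
    ((continuous_switchFun θ).abs.integral_hasStrictDerivAt 0 τ).hasDerivAt
  have hi' := hi.comp_hasFDerivAt (τ, p) hT
  have h := ((((h1.add (hT.mul h2)).const_mul (cos θ)).add (h2.const_mul (sin θ))).sub_const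
    l).sub hi'
  refine h.congr_fderiv ?_
  ext <;> simp [switchFun]; ring

/-- The value function is differentiable along the extremals, with gradient the costate. -/
lemma hasFDerivAt_value_extremal {l : ℝ} (hl : 0 < l) (hl1 : l ≤ 1) {θ : ℝ} (hθ : sin θ ≠ 0)
    {τ : ℝ} (hτ : 0 < τ) :
    HasFDerivAt (value l)
      ((charCostate l θ τ).1 • ContinuousLinearMap.fst ℝ ℝ ℝ +
        (charCostate l θ τ).2 • ContinuousLinearMap.snd ℝ ℝ ℝ) (extremal l θ τ) := by
  set d := |sin θ| - l * sin θ * cos θ with hd_def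
  have hd : 0 < d := costate_denominator_pos hl hl1 hθ
  set p := extremal l θ τ with hp
  have hext : ∀ᶠ q in 𝓝 (τ, p), q.2 ∈ exterior l ∧ 0 < q.1 := by
    have h1 : Tendsto (fun q : ℝ × ℝ × ℝ => q.2) (𝓝 (τ, p)) (𝓝 p) := continuousAt_snd
    have h2 : Tendsto (fun q : ℝ × ℝ × ℝ => q.1) (𝓝 (τ, p)) (𝓝 τ) := continuousAt_fst
    exact (h1.eventually ((isOpen_exterior l).mem_nhds (extremal_mem_exterior hl hl1 θ hτ))).and
      (h2.eventually (lt_mem_nhds hτ))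
  -- The extremal control from p, taken on the whole line because nearby terminal times may exceed
  -- τ.
  set u : ℝ → ℝ := fun t => -Real.sign (switchFun θ (τ - t)) with hu
  have humeas : Measurable u :=
    ((measurable_sign_switchFun θ).comp (measurable_const.sub measurable_id)).neg
  have hub : ∀ t, |u t| ≤ 1 := fun t => by
    rw [hu, abs_neg]; exact abs_sign_le_one _
  have hui : ∀ a b, IntervalIntegrable u volume a b := fun a b =>
    intervalIntegrable_of_abs_le_one humeas fun t _ => hub t
  set y : ℝ → ℝ := fun t => ∫ s in (0 : ℝ)..t, u s with hy
  have hyc : Continuous y := intervalIntegral.continuous_primitive hui 0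
  have htraj := isTrajectory_extremal l θ hτ.le
  have hend1 : l * cos θ = p.1 + τ * p.2 + ∫ s in (0 : ℝ)..τ, y s := by
    have := htraj.fst_formula (right_mem_Icc.2 hτ.le)
    rwa [sub_self, extremal_zero] at this
  have hend2 : l * sin θ = p.2 + y τ := by
    have := htraj.snd_formula (right_mem_Icc.2 hτ.le)
    rwa [sub_self, extremal_zero] at this
  -- The control is continuous at τ since sin θ ≠ 0: no switching occurs on arrival.
  have hdy : HasDerivAt y (-Real.sign (sin θ)) τ := by
    have hc : ContinuousAt u τ := by
      refine ContinuousAt.neg ?_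
      refine ContinuousAt.comp (g := Real.sign) (f := fun t => switchFun θ (τ - t)) ?_ ?_
      · refine continuousAt_sign ?_
        simpa [switchFun] using hθ
      · exact ((continuous_switchFun θ).comp (continuous_const.sub continuous_id)).continuousAt
    have := intervalIntegral.integral_hasDerivAt_right (hui 0 τ)
      (humeas.stronglyMeasurable.stronglyMeasurableAtFilter) hc
    have e : u τ = -Real.sign (sin θ) := by simp [hu, switchFun]
    rwa [e] at this
  have hdY : HasDerivAt (fun t => ∫ s in (0 : ℝ)..t, y s) (y τ) τ :=
    (hyc.integral_hasStrictDerivAt 0 τ).hasDerivAt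
  have hham := cos_mul_extremalSnd_sub l θ τ
  have hp2 : extremalSnd l θ τ = p.2 := rfl
  rw [hp2] at hham
  -- φ is the support gap in direction θ: positivity at (t, x) rules out V(x) ≤ t. ψ is |y(t)|² - l²
  -- for the end point y(t) reached from x with the fixed control u: negativity means that the disc
  -- is entered by time t. The time derivatives are -d and -2ld.
  refine hasFDerivAt_of_squeeze (φ := fun q => supportGap l q.1 θ q.2)
    (ψ := fun q => (q.2.1 + q.1 * q.2.2 + ∫ s in (0 : ℝ)..q.1, y s) ^ 2 +
      (q.2.2 + y q.1) ^ 2 - l ^ 2) hd (by positivity : 0 < 2 * l * d) ?_ ?_ ?_ ?_ ?_ ?_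
      (value_extremal hl hl1 θ hτ.le)
  · refine (hasFDerivAt_supportGap l θ p).congr_fderiv ?_
    ext
    · simp; linarith
    · simp [charCostate, ← hd_def]; field_simp
    · simp [charCostate, ← hd_def, switchFun]; field_simp
  · have := extremal_pairing_self l θ hτ.le
    simp only [supportGap]
    linarith
  · have hT : HasFDerivAt (𝕜 := ℝ) (fun q : ℝ × ℝ × ℝ => q.1) _ (τ, p) := hasFDerivAt_fst
    have hX := (hasFDerivAt_snd : HasFDerivAt (𝕜 := ℝ) (fun q : ℝ × ℝ × ℝ => q.2) _ (τ, p))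
    have h1 := hX.fst
    have h2 := hX.snd
    have hY' := hdY.comp_hasFDerivAt (τ, p) hT
    have hy' := hdy.comp_hasFDerivAt (τ, p) hT
    have h := ((((h1.add (hT.mul h2)).add hY').pow 2).add ((h2.add hy').pow 2)).sub_const (l ^ 2)
    refine h.congr_fderiv ?_
    have hs : Real.sign (sin θ) * sin θ = |sin θ| := sign_mul_self _
    ext
    · simp [← hend1, ← hend2]
      rw [hd_def]
      linear_combination (2 * l * cos θ) * (-hend2) - (2 * l) * hs
    · simp [charCostate, ← hd_def, ← hend1, ← hend2]; field_simp
    · simp [charCostate, ← hd_def, ← hend1, ← hend2]; field_simp; ring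
  · simp only [← hend1, ← hend2]
    linear_combination l ^ 2 * sin_sq_add_cos_sq θ
  · filter_upwards [hext] with q hq hpos
    by_contra! hlt
    exact absurd (supportGap_nonpos_of_value_le hl hl1 hq.1 hlt.le θ) (not_le.2 hpos)
  · filter_upwards [hext] with q hq hneg
    exact value_le_of_mem_disc hl hl1 hq.1 (isTrajectory_primitive humeas hub q.2 hq.2.le)
      (le_of_sub_nonpos hneg.le)

/-! ### Closed forms -/

lemma switchFun_eq_cos_mul {θ : ℝ} (h : cos θ ≠ 0) (s : ℝ) :
    switchFun θ s = cos θ * (tan θ + s) := by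
  rw [switchFun, tan_eq_sin_div_cos]
  field_simp

lemma cos_neg_of_mem {θ : ℝ} (h : θ ∈ Ioo (π / 2) π) : cos θ < 0 :=
  cos_neg_of_pi_div_two_lt_of_lt h.1 (by linarith [h.2, pi_pos])

lemma sin_pos_of_mem {θ : ℝ} (h : θ ∈ Ioo (π / 2) π) : 0 < sin θ :=
  sin_pos_of_pos_of_lt_pi (by linarith [h.1, pi_pos]) h.2

lemma neg_tan_pos {θ : ℝ} (h : θ ∈ Ioo (π / 2) π) : 0 < -tan θ := by
  rw [tan_eq_sin_div_cos, ← div_neg]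
  exact div_pos (sin_pos_of_mem h) (neg_pos.2 (cos_neg_of_mem h))

lemma switchFun_pos {θ s : ℝ} (hθ : θ ∈ Ioo 0 π) (hs : 0 ≤ s) (h : π / 2 < θ → s < -tan θ) :
    0 < switchFun θ s := by
  have h0 : 0 < sin θ := sin_pos_of_pos_of_lt_pi hθ.1 hθ.2
  rcases le_or_gt θ (π / 2) with hc | hc
  · have : 0 ≤ cos θ := cos_nonneg_of_mem_Icc ⟨by linarith [hθ.1, pi_pos], hc⟩
    rw [switchFun]
    positivity
  · have hcos := cos_neg_of_mem ⟨hc, hθ.2⟩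
    rw [switchFun_eq_cos_mul hcos.ne]
    exact mul_pos_of_neg_of_neg hcos (by linarith [h hc])

lemma extremal_eq_before_switch {l θ τ : ℝ} (hθ : θ ∈ Ioo 0 π) (hτ : 0 ≤ τ)
    (h : π / 2 < θ → τ ≤ -tan θ) :
    extremal l θ τ = (l * (cos θ - τ * sin θ) - τ ^ 2 / 2, l * sin θ + τ) := by
  rw [extremal_of_sign_eq hτ (ε := 1) fun s hs =>
    Real.sign_of_pos (switchFun_pos hθ hs.1.le fun hc => hs.2.trans_le (h hc))]
  simp

/-- After the switch σ ≤ 0, and the conserved Hamiltonian determines x₂ algebraically; x₁ is then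
integrated from the switching time -tan θ. -/
lemma extremal_eq_after_switch {l θ τ : ℝ} (hθ : θ ∈ Ioo (π / 2) π) (h : -tan θ ≤ τ) :
    extremal l θ τ = (l * (cos θ - τ * sin θ) + τ ^ 2 / 2 + tan θ ^ 2 + 2 * τ * tan θ,
        l * sin θ - 2 * tan θ - τ) := by
  have hcos := cos_neg_of_mem hθ
  have hsin := sin_pos_of_mem hθ
  have hθ' : θ ∈ Ioo 0 π := ⟨by linarith [hθ.1, pi_pos], hθ.2⟩
  have htan := neg_tan_pos hθ
  have hsnd : ∀ s, -tan θ ≤ s → extremalSnd l θ s = l * sin θ - 2 * tan θ - s := by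
    intro s hs
    have h1 := cos_mul_extremalSnd_sub l θ s
    have h2 : switchFun θ s ≤ 0 := by
      rw [switchFun_eq_cos_mul hcos.ne]
      exact mul_nonpos_of_nonpos_of_nonneg hcos.le (by linarith)
    rw [abs_of_nonpos h2, abs_of_pos hsin, switchFun] at h1
    have h3 : tan θ * cos θ = sin θ := tan_mul_cos hcos.ne
    refine mul_left_cancel₀ hcos.ne ?_
    linear_combination h1 + 2 * h3
  have h0 := extremal_eq_before_switch (l := l) hθ' htan.le fun _ => le_rfl
  have h1 : (extremal l θ τ).1 = (extremal l θ (-tan θ)).1 -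
      ∫ s in (-tan θ)..τ, extremalSnd l θ s := by
    have := intervalIntegral.integral_add_adjacent_intervals (μ := volume)
      ((continuous_extremalSnd l θ).intervalIntegrable 0 (-tan θ))
      ((continuous_extremalSnd l θ).intervalIntegrable (-tan θ) τ)
    simp only [extremal]
    linarith
  have h2 : ∫ s in (-tan θ)..τ, extremalSnd l θ s =
      ∫ s in (-tan θ)..τ, ((l * sin θ - 2 * tan θ) - s) := by
    refine intervalIntegral.integral_congr fun s hs => hsnd s ?_
    rw [uIcc_of_le h] at hs
    exact hs.1
  rw [intervalIntegral.integral_sub intervalIntegrable_const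
    intervalIntegral.intervalIntegrable_id] at h2
  ext
  · rw [h1, h2, h0]
    simp
    ring
  · exact hsnd τ h

lemma sub_pi_mem {θ : ℝ} (hθ : θ ∈ Ioo π (2 * π)) : θ - π ∈ Ioo 0 π :=
  ⟨by linarith [hθ.1], by linarith [hθ.2]⟩

lemma extremal_eq_neg_sub_pi (l θ τ : ℝ) : extremal l θ τ = -extremal l (θ - π) τ := by
  rw [← extremal_add_pi, sub_add_cancel]

/-- Converts the case distinction of `charState` into comparison with the switching time -tan θ,
which exists only for θ > π/2. -/
lemma lt_pi_sub_arctan_iff {θ τ : ℝ} (hθ : θ ∈ Ioo 0 π) :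
    θ < π - arctan τ ↔ (π / 2 < θ → τ < -tan θ) := by
  have ha := arctan_lt_pi_div_two τ
  constructor
  · intro h hc
    have h1 : arctan τ < π - θ := by linarith
    have h2 := tan_lt_tan_of_lt_of_lt_pi_div_two (by linarith [neg_pi_div_two_lt_arctan τ])
      (by linarith) h1
    rwa [tan_arctan, tan_pi_sub] at h2
  · intro h
    rcases le_or_gt θ (π / 2) with hc | hc
    · linarith
    · have := arctan_strictMono (h hc)
      rw [← tan_pi_sub, arctan_tan (by linarith [hθ.2]) (by linarith)] at this
      linarith

lemma charState_eq_extremal_of_lt_pi {l θ τ : ℝ} (hθ : θ ∈ Ioo 0 π) (hτ : 0 ≤ τ) :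
    charState l θ τ = extremal l θ τ := by
  rw [charState, if_pos hθ.2]
  split_ifs with h
  · rw [extremal_eq_before_switch hθ hτ fun hc => ((lt_pi_sub_arctan_iff hθ).1 h hc).le]
  · rw [lt_pi_sub_arctan_iff hθ] at h
    push Not at h
    rw [extremal_eq_after_switch ⟨h.1, hθ.2⟩ h.2]

lemma charState_eq_neg_sub_pi {l θ τ : ℝ} (hθ : θ ∈ Ioo π (2 * π)) :
    charState l θ τ = -charState l (θ - π) τ := by
  have h1 : ¬ θ < π := by linarith [hθ.1]
  have h2 : θ - π < π := by linarith [hθ.2]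
  have h3 : θ - π < π - arctan τ ↔ θ < 2 * π - arctan τ := by
    constructor <;> intro h <;> linarith
  rw [charState, charState, if_neg h1, if_pos h2]
  simp only [h3, tan_sub_pi, cos_sub_pi, sin_sub_pi]
  split_ifs <;> ext <;> simp <;> ring

lemma charState_eq_extremal {l θ τ : ℝ} (hθ : θ ∈ usableAngles) (hτ : 0 ≤ τ) :
    charState l θ τ = extremal l θ τ := by
  rcases hθ with h | h
  · exact charState_eq_extremal_of_lt_pi h hτ
  · rw [charState_eq_neg_sub_pi h, charState_eq_extremal_of_lt_pi (sub_pi_mem h) hτ,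
      extremal_eq_neg_sub_pi l θ]

lemma arcRight_eq_extremal {l τ : ℝ} (hτ : 0 ≤ τ) : arcRight l τ = extremal l 0 τ := by
  rw [extremal_of_sign_eq hτ (ε := 1) fun s hs =>
    Real.sign_of_pos (by simpa [switchFun] using hs.1)]
  simp [arcRight]

lemma arcLeft_eq_extremal {l τ : ℝ} (hτ : 0 ≤ τ) : arcLeft l τ = extremal l π τ := by
  have := extremal_add_pi l 0 τ
  rw [zero_add] at this
  rw [this, ← arcRight_eq_extremal hτ]
  simp [arcLeft, arcRight]
  ring

lemma sin_ne_zero_of_mem {θ : ℝ} (hθ : θ ∈ usableAngles) : sin θ ≠ 0 := by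
  rcases hθ with h | h
  · exact (sin_pos_of_pos_of_lt_pi h.1 h.2).ne'
  · have := sin_pos_of_pos_of_lt_pi (sub_pi_mem h).1 (sub_pi_mem h).2
    rw [sin_sub_pi] at this
    linarith

lemma mem_usableAngles {θ : ℝ} (hθ : θ ∈ Icc 0 (2 * π)) (h : sin θ ≠ 0) : θ ∈ usableAngles := by
  have h0 : θ ≠ 0 := fun e => h (by simp [e])
  have h1 : θ ≠ π := fun e => h (by simp [e])
  have h2 : θ ≠ 2 * π := fun e => h (by simp [e])
  rcases lt_or_gt_of_ne h1 with hlt | hgt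
  · exact .inl ⟨lt_of_le_of_ne hθ.1 h0.symm, hlt⟩
  · exact .inr ⟨hgt, lt_of_le_of_ne hθ.2 h2⟩

lemma usableAngles_subset : usableAngles ⊆ Ico 0 (2 * π) := by
  rintro θ (h | h)
  · exact ⟨h.1.le, by linarith [h.2, pi_pos]⟩
  · exact ⟨by linarith [h.1, pi_pos], h.2⟩

lemma eq_of_cos_eq_of_sin_eq {θ θ' : ℝ} (h : θ ∈ Ico 0 (2 * π)) (h' : θ' ∈ Ico 0 (2 * π))
    (hc : cos θ = cos θ') (hs : sin θ = sin θ') : θ = θ' := by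
  have h1 : cos (θ - θ') = 1 := by
    rw [cos_sub, hc, hs]
    nlinarith [sin_sq_add_cos_sq θ']
  have h2 := (cos_eq_one_iff_of_lt_of_lt (by linarith [h.1, h'.2]) (by linarith [h.2, h'.1])).1 h1
  linarith

/-- Every exterior state lies on an extremal with angle in `[0, 2π)`. -/
lemma exists_extremal_mem_Ico {l : ℝ} (hl : 0 < l) {p : ℝ × ℝ} (hp : p ∈ exterior l) :
    ∃ θ ∈ Ico 0 (2 * π), ∃ τ, 0 < τ ∧ p = extremal l θ τ := by
  obtain ⟨θ, τ, hτ, rfl⟩ := exists_extremal hl hp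
  have hper : Function.Periodic (fun θ => extremal l θ τ) (2 * π) := fun θ => by
    have := extremal_sub_two_pi l (θ + 2 * π) τ
    rw [add_sub_cancel_right] at this
    exact this.symm
  obtain ⟨φ, hφ, e⟩ := hper.exists_mem_Ico₀ (by positivity) θ
  exact ⟨φ, hφ, τ, hτ, e⟩

/-! ### The usable part -/

lemma minNormalSpeed_eq (l θ : ℝ) : minNormalSpeed l θ = -(|sin θ| - l * sin θ * cos θ) := by
  refine IsLeast.csInf_eq ⟨⟨-Real.sign (sin θ), ?_, ?_⟩, ?_⟩
  · have := sign_mem_Icc (sin θ)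
    exact ⟨by linarith [this.2], by linarith [this.1]⟩
  · simp only [normalSpeed, vectorField, circlePoint]
    linear_combination -sign_mul_self (sin θ)
  · rintro _ ⟨u, hu, rfl⟩
    simp only [normalSpeed, vectorField, circlePoint]
    have h1 : |sin θ * u| ≤ |sin θ| := by
      rw [abs_mul]
      exact mul_le_of_le_one_right (abs_nonneg _) (abs_le.2 hu)
    linarith [neg_abs_le (sin θ * u)]

lemma minNormalSpeed_neg {l : ℝ} (hl : 0 < l) (hl1 : l ≤ 1) {θ : ℝ} (h : sin θ ≠ 0) :
    minNormalSpeed l θ < 0 := by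
  rw [minNormalSpeed_eq]
  linarith [costate_denominator_pos hl hl1 h]

lemma minNormalSpeed_eq_zero (l : ℝ) {θ : ℝ} (h : sin θ = 0) : minNormalSpeed l θ = 0 := by
  simp [minNormalSpeed_eq, h]

lemma UP_eq {l : ℝ} (hl : 0 < l) (hl1 : l ≤ 1) : UP l = circlePoint l '' usableAngles := by
  ext p
  constructor
  · rintro ⟨θ, hθ, rfl, hm⟩
    exact ⟨θ, mem_usableAngles hθ fun h => hm.ne (minNormalSpeed_eq_zero l h), rfl⟩
  · rintro ⟨θ, hθ, rfl⟩
    exact ⟨θ, Ico_subset_Icc_self (usableAngles_subset hθ), rfl,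
      minNormalSpeed_neg hl hl1 (sin_ne_zero_of_mem hθ)⟩

lemma BUP_eq {l : ℝ} (hl : 0 < l) (hl1 : l ≤ 1) : BUP l = {(-l, 0), (l, 0)} := by
  ext p
  constructor
  · rintro ⟨θ, hθ, rfl, hm⟩
    have hs : sin θ = 0 := by
      by_contra h
      exact (minNormalSpeed_neg hl hl1 h).ne hm
    rcases sin_eq_zero_iff_cos_eq.1 hs with h | h
    · exact .inr (by simp [circlePoint, hs, h])
    · exact .inl (by simp [circlePoint, hs, h])
  · rintro (rfl | rfl)
    · exact ⟨π, ⟨pi_pos.le, by linarith [pi_pos]⟩, by simp [circlePoint],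
        minNormalSpeed_eq_zero l sin_pi⟩
    · exact ⟨0, ⟨le_rfl, by positivity⟩, by simp [circlePoint], minNormalSpeed_eq_zero l sin_zero⟩

lemma NUP_eq {l : ℝ} (hl : 0 < l) (hl1 : l ≤ 1) : NUP l = ∅ := by
  refine eq_empty_of_forall_notMem ?_
  rintro p ⟨θ, hθ, rfl, hm⟩
  rcases eq_or_ne (sin θ) 0 with h | h
  · exact hm.ne' (minNormalSpeed_eq_zero l h)
  · exact hm.not_gt (minNormalSpeed_neg hl hl1 h)

/-! ### Characteristics -/

lemma sign_mul_of_pos {c : ℝ} (hc : 0 < c) (a : ℝ) : Real.sign (c * a) = Real.sign a := by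
  rcases lt_trichotomy a 0 with h | h | h
  · rw [Real.sign_of_neg h, Real.sign_of_neg (mul_neg_of_pos_of_neg hc h)]
  · simp [h]
  · rw [Real.sign_of_pos h, Real.sign_of_pos (mul_pos hc h)]

lemma charCostate_snd (l θ τ : ℝ) :
    (charCostate l θ τ).2 = (|sin θ| - l * sin θ * cos θ)⁻¹ * switchFun θ τ := by
  simp only [charCostate, switchFun, div_eq_inv_mul]

lemma sign_charCostate {l : ℝ} (hl : 0 < l) (hl1 : l ≤ 1) {θ : ℝ} (hθ : sin θ ≠ 0) (τ : ℝ) :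
    Real.sign (charCostate l θ τ).2 = Real.sign (switchFun θ τ) := by
  rw [charCostate_snd, sign_mul_of_pos (inv_pos.2 (costate_denominator_pos hl hl1 hθ))]

/-- The costate equations do not involve the state, so they integrate at once up to the factor a;
the Hamiltonian condition at τ = 0 fixes a as the inverse denominator. The sign of λ₂ is then that
of σ, and the state is the extremal. -/
lemma isCharacteristic_iff {l : ℝ} (hl : 0 < l) (hl1 : l ≤ 1) {θ : ℝ} (hθ : θ ∈ usableAngles)
    (x p : ℝ → ℝ × ℝ) : IsCharacteristic l θ x p ↔
      ∀ τ, 0 ≤ τ → x τ = charState l θ τ ∧ p τ = charCostate l θ τ := by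
  have hs := sin_ne_zero_of_mem hθ
  have hd := costate_denominator_pos hl hl1 hs
  constructor
  · intro h
    obtain ⟨a, ha, hp0⟩ := h.costate_zero
    have hham := h.hamiltonian_zero
    simp only [optHamiltonian, h.state_zero, hp0, circlePoint, abs_mul, abs_of_pos ha] at hham
    have ha' : a = (|sin θ| - l * sin θ * cos θ)⁻¹ := by
      exact eq_inv_of_mul_eq_one_left (by linarith)
    have hp1 : ∀ τ, 0 ≤ τ → (p τ).1 = a * cos θ := fun τ hτ => by
      rw [h.costate_fst τ hτ, hp0]
    have hp2 : ∀ τ, 0 ≤ τ → (p τ).2 = a * switchFun θ τ := fun τ hτ => by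
      have e : ∫ s in (0 : ℝ)..τ, (p s).1 = ∫ _ in (0 : ℝ)..τ, a * cos θ := by
        refine intervalIntegral.integral_congr fun s hs => hp1 s ?_
        rw [uIcc_of_le hτ] at hs
        exact hs.1
      rw [h.costate_snd τ hτ, hp0, e, switchFun]
      simp only [intervalIntegral.integral_const, sub_zero, smul_eq_mul]
      ring
    have hx2 : ∀ τ, 0 ≤ τ → (x τ).2 = extremalSnd l θ τ := fun τ hτ => by
      rw [h.state_snd τ hτ, h.state_zero, extremalSnd, circlePoint]
      congr 1
      refine intervalIntegral.integral_congr fun s hs => ?_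
      rw [uIcc_of_le hτ] at hs
      rw [hp2 s hs.1, sign_mul_of_pos ha]
    intro τ hτ
    refine ⟨?_, ?_⟩
    · rw [charState_eq_extremal hθ hτ]
      ext
      · have e : ∫ s in (0 : ℝ)..τ, -(x s).2 = ∫ s in (0 : ℝ)..τ, -extremalSnd l θ s := by
          refine intervalIntegral.integral_congr fun s hs => ?_
          rw [uIcc_of_le hτ] at hs
          rw [hx2 s hs.1]
        rw [h.state_fst τ hτ, h.state_zero, e, circlePoint, extremal, intervalIntegral.integral_neg]
        ring
      · exact hx2 τ hτ
    · ext
      · rw [hp1 τ hτ, ha', charCostate, div_eq_inv_mul]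
      · rw [hp2 τ hτ, ha', charCostate_snd]
  · intro h
    have hx : ∀ τ, 0 ≤ τ → x τ = extremal l θ τ := fun τ hτ => by
      rw [(h τ hτ).1, charState_eq_extremal hθ hτ]
    have hp : ∀ τ, 0 ≤ τ → p τ = charCostate l θ τ := fun τ hτ => (h τ hτ).2
    have hx0 := hx 0 le_rfl
    have hp0 := hp 0 le_rfl
    rw [extremal_zero] at hx0
    refine ⟨hx0, ⟨(|sin θ| - l * sin θ * cos θ)⁻¹, inv_pos.2 hd, ?_⟩, ?_, ?_, ?_, ?_, ?_⟩
    · rw [hp0]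
      ext
      · simp [charCostate, div_eq_inv_mul]
      · simp [charCostate, div_eq_inv_mul]
    · rw [hx0, hp0]
      simp only [optHamiltonian, charCostate, zero_mul, add_zero, abs_div, abs_of_pos hd]
      generalize hD : |sin θ| - l * sin θ * cos θ = D at hd
      field_simp
      linarith
    · intro τ hτ
      have e : ∫ s in (0 : ℝ)..τ, -(x s).2 = ∫ s in (0 : ℝ)..τ, -extremalSnd l θ s := by
        refine intervalIntegral.integral_congr fun s hs => ?_
        rw [uIcc_of_le hτ] at hs
        rw [hx s hs.1]
        rfl
      rw [hx τ hτ, hx0, e, extremal, intervalIntegral.integral_neg]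
      ring
    · intro τ hτ
      have e : ∫ s in (0 : ℝ)..τ, Real.sign (p s).2 =
          ∫ s in (0 : ℝ)..τ, Real.sign (switchFun θ s) := by
        refine intervalIntegral.integral_congr fun s hs' => ?_
        rw [uIcc_of_le hτ] at hs'
        rw [hp s hs'.1, sign_charCostate hl hl1 hs]
      rw [hx τ hτ, hx0, e]
      rfl
    · intro τ hτ
      rw [hp τ hτ, hp0]
      rfl
    · intro τ hτ
      have e : ∫ s in (0 : ℝ)..τ, (p s).1 =
          ∫ _ in (0 : ℝ)..τ, cos θ / (|sin θ| - l * sin θ * cos θ) := by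
        refine intervalIntegral.integral_congr fun s hs => ?_
        rw [uIcc_of_le hτ] at hs
        rw [hp s hs.1]
        rfl
      rw [hp τ hτ, hp0, e]
      simp only [charCostate, intervalIntegral.integral_const, smul_eq_mul]
      field_simp
      ring

lemma optHamiltonian_extremal {l : ℝ} (hl : 0 < l) (hl1 : l ≤ 1) {θ : ℝ} (hθ : sin θ ≠ 0)
    (τ : ℝ) : optHamiltonian (extremal l θ τ) (charCostate l θ τ) = 0 := by
  have hd := costate_denominator_pos hl hl1 hθ
  have h := cos_mul_extremalSnd_sub l θ τ
  rw [optHamiltonian, charCostate_snd, abs_mul, abs_of_pos (inv_pos.2 hd)]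
  simp only [charCostate, extremal]
  generalize hD : |sin θ| - l * sin θ * cos θ = D at hd
  field_simp
  linarith

lemma parabola_before_switch {l θ τ : ℝ} (hθ : θ ∈ Ioo 0 π) (hτ : 0 ≤ τ)
    (h : π / 2 < θ → τ ≤ -tan θ) :
    (extremal l θ τ).1 = -(extremal l θ τ).2 ^ 2 / 2 + l * cos θ + l ^ 2 * sin θ ^ 2 / 2 := by
  rw [extremal_eq_before_switch hθ hτ h]
  ring

lemma parabola_after_switch {l θ τ : ℝ} (hθ : θ ∈ Ioo (π / 2) π) (h : -tan θ ≤ τ) :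
    (extremal l θ τ).1 = (extremal l θ τ).2 ^ 2 / 2 + l * cos θ
        + 2 * l * sin θ ^ 2 / cos θ - l ^ 2 * sin θ ^ 2 / 2 - tan θ ^ 2 := by
  rw [extremal_eq_after_switch hθ h]
  have : 2 * l * sin θ ^ 2 / cos θ = 2 * l * sin θ * tan θ := by
    rw [tan_eq_sin_div_cos]; ring
  rw [this]
  ring

lemma sub_pi_mem_upper {θ : ℝ} (hθ : θ ∈ Ioo (3 * π / 2) (2 * π)) : θ - π ∈ Ioo (π / 2) π :=
  ⟨by linarith [hθ.1], by linarith [hθ.2]⟩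

/-! ### The switching lines -/

lemma extremal_neg_tan {l θ : ℝ} (hθ : θ ∈ Ioo (π / 2) π) :
    extremal l θ (-tan θ) = switch1 l θ := by
  have hcos := (cos_neg_of_mem hθ).ne
  rw [extremal_eq_before_switch ⟨by linarith [hθ.1, pi_pos], hθ.2⟩ (neg_tan_pos hθ).le
    fun _ => le_rfl, switch1]
  ext
  · have h : cos θ - -tan θ * sin θ = 1 / cos θ := by
      rw [tan_eq_sin_div_cos]
      field_simp
      linarith [sin_sq_add_cos_sq θ]
    simp only [h]
    ring
  · simp only
    ring

lemma switch2_eq_neg (l θ : ℝ) : switch2 l θ = -switch1 l (θ - π) := by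
  ext
  · simp [switch1, switch2, cos_sub_pi, tan_sub_pi, div_neg]
    ring
  · simp [switch1, switch2, sin_sub_pi, tan_sub_pi]
    ring

lemma tendsto_switch1 (l : ℝ) : Tendsto (switch1 l) (𝓝[<] π) (𝓝 (-l, 0)) := by
  have hc : cos π ≠ 0 := by simp
  have h : ContinuousAt (switch1 l) π := by
    have h1 : ContinuousAt tan π := continuousAt_tan.2 hc
    have h2 : ContinuousAt (fun θ => l / cos θ) π :=
      continuousAt_const.div continuous_cos.continuousAt hc
    exact (h2.sub ((h1.pow 2).div_const 2)).prodMk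
      ((continuousAt_const.mul continuous_sin.continuousAt).sub h1)
  have e : switch1 l π = (-l, 0) := by simp [switch1, div_neg]
  rw [← e]
  exact h.tendsto.mono_left nhdsWithin_le_nhds

lemma tendsto_switch2 (l : ℝ) : Tendsto (switch2 l) (𝓝[<] (2 * π)) (𝓝 (l, 0)) := by
  have h1 : Tendsto (fun θ => θ - π) (𝓝[<] (2 * π)) (𝓝[<] π) := by
    refine tendsto_nhdsWithin_iff.2 ⟨?_, ?_⟩
    · have : Tendsto (fun θ : ℝ => θ - π) (𝓝 (2 * π)) (𝓝 (2 * π - π)) :=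
        (continuous_id.sub continuous_const).tendsto _
      rw [two_mul, add_sub_cancel_right] at this
      rw [two_mul]
      exact this.mono_left nhdsWithin_le_nhds
    · filter_upwards [self_mem_nhdsWithin] with θ hθ
      simp only [mem_Iio] at hθ ⊢
      linarith
  have h2 := ((tendsto_switch1 l).comp h1).neg
  simp only [Prod.neg_mk, neg_neg, neg_zero] at h2
  refine h2.congr fun θ => ?_
  rw [switch2_eq_neg]
  rfl

/-- With c = -1/cos θ and tan² θ = c² - 1, the quantity l² + 1 - 2x₁ is the perfect square (l + c)².
The root in `switchGraph1` is thus l + c, and c is recovered by subtracting l. -/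
lemma switch1_mem_graph {l : ℝ} (hl : 0 < l) {θ : ℝ} (hθ : θ ∈ Ioo (π / 2) π) :
    (switch1 l θ).1 < -l ∧ switchGraph1 l (switch1 l θ).1 = (switch1 l θ).2 := by
  have hcos := cos_neg_of_mem hθ
  have hsin := sin_pos_of_mem hθ
  set c := -(cos θ)⁻¹ with hc
  have hcc : c * cos θ = -1 := by
    rw [hc, neg_mul, inv_mul_cancel₀ hcos.ne]
  have htan := neg_tan_pos hθ
  have ht : tan θ ^ 2 = c ^ 2 - 1 := by
    rw [tan_eq_sin_div_cos, hc, div_pow, neg_sq, inv_pow]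
    have := hcos.ne
    field_simp
    linarith [sin_sq_add_cos_sq θ]
  have hc1 : 1 < c := by
    have hc0 : 0 < c := by rw [hc, neg_pos]; exact inv_lt_zero.2 hcos
    nlinarith
  have hx : (switch1 l θ).1 = -(l * c) - (c ^ 2 - 1) / 2 := by
    simp only [switch1, ht, hc, div_eq_mul_inv]; ring
  refine ⟨by rw [hx]; nlinarith, ?_⟩
  have hr : √(l ^ 2 + 1 - 2 * (switch1 l θ).1) = l + c := by
    rw [hx, show l ^ 2 + 1 - 2 * (-(l * c) - (c ^ 2 - 1) / 2) = (l + c) ^ 2 by ring]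
    exact Real.sqrt_sq (by linarith)
  have hq : √(l ^ 2 - (switch1 l θ).1 - l * (l + c)) = -tan θ / √2 := by
    rw [hx, show l ^ 2 - (-(l * c) - (c ^ 2 - 1) / 2) - l * (l + c) = (c ^ 2 - 1) / 2 by ring,
      ← ht, Real.sqrt_div (sq_nonneg _), Real.sqrt_sq_eq_abs, abs_of_neg (by linarith)]
  have h2 : √2 ≠ 0 := by positivity
  rw [switchGraph1, hr, hq]
  have h3 : (switch1 l θ).2 = l * sin θ - tan θ := rfl
  have h4 : sin θ * c = -tan θ := by
    rw [tan_eq_sin_div_cos, hc]; ring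
  rw [h3, add_sub_cancel_left]
  have hc0 : c ≠ 0 := by linarith
  field_simp
  linear_combination -l * h4

/-- Inverts that parametrization: c = √(l² + 1 - 2x) - l exceeds 1, and θ is the angle with cos θ =
-1/c. -/
lemma exists_switch1_fst_eq {l : ℝ} (hl : 0 < l) {x : ℝ} (hx : x < -l) :
    ∃ θ ∈ Ioo (π / 2) π, (switch1 l θ).1 = x := by
  set r := √(l ^ 2 + 1 - 2 * x) with hr
  have hr2 : r ^ 2 = l ^ 2 + 1 - 2 * x := Real.sq_sqrt (by nlinarith)
  have hr1 : l + 1 < r := Real.lt_sqrt_of_sq_lt (by nlinarith)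
  set c := r - l with hc
  have hc1 : 1 < c := by linarith
  have hcinv : c⁻¹ < 1 := inv_lt_one_of_one_lt₀ hc1
  have hcpos : 0 < c⁻¹ := by positivity
  refine ⟨π - arccos c⁻¹, ⟨?_, ?_⟩, ?_⟩
  · linarith [arccos_lt_pi_div_two.2 hcpos]
  · linarith [arccos_pos.2 hcinv]
  · have hcos : cos (π - arccos c⁻¹) = -c⁻¹ := by
      rw [cos_pi_sub, cos_arccos (by linarith) hcinv.le]
    have htan : tan (π - arccos c⁻¹) ^ 2 = c ^ 2 - 1 := by
      have h0 : cos (π - arccos c⁻¹) ≠ 0 := by rw [hcos]; linarith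
      have := inv_one_add_tan_sq h0
      rw [hcos, neg_sq, inv_pow, inv_inj] at this
      linarith
    simp only [switch1]
    rw [htan, hcos, div_neg, div_inv_eq_mul]
    rw [hc]
    linarith

lemma switch1_image {l : ℝ} (hl : 0 < l) :
    switch1 l '' Ioo (π / 2) π = (fun x₁ => (x₁, switchGraph1 l x₁)) '' Iio (-l) := by
  ext p
  constructor
  · rintro ⟨θ, hθ, rfl⟩
    obtain ⟨h1, h2⟩ := switch1_mem_graph hl hθ
    exact ⟨_, h1, Prod.ext rfl h2⟩
  · rintro ⟨x, hx, rfl⟩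
    obtain ⟨θ, hθ, rfl⟩ := exists_switch1_fst_eq hl hx
    exact ⟨θ, hθ, Prod.ext rfl (switch1_mem_graph hl hθ).2.symm⟩

lemma switchGraph2_eq_neg (l x : ℝ) : switchGraph2 l x = -switchGraph1 l (-x) := by
  simp only [switchGraph1, switchGraph2, mul_neg, sub_neg_eq_add, neg_mul]

lemma switch2_image {l : ℝ} (hl : 0 < l) :
    switch2 l '' Ioo (3 * π / 2) (2 * π) = (fun x₁ => (x₁, switchGraph2 l x₁)) '' Ioi l := by
  ext p
  constructor
  · rintro ⟨θ, hθ, rfl⟩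
    obtain ⟨h1, h2⟩ := switch1_mem_graph hl (sub_pi_mem_upper hθ)
    refine ⟨-(switch1 l (θ - π)).1, by simp only [mem_Ioi]; linarith, ?_⟩
    simp only [switchGraph2_eq_neg, neg_neg, h2, switch2_eq_neg]
    rfl
  · rintro ⟨x, hx, rfl⟩
    obtain ⟨θ, hθ, e⟩ := exists_switch1_fst_eq hl (x := -x) (neg_lt_neg hx)
    refine ⟨θ + π, ⟨by linarith [hθ.1], by linarith [hθ.2]⟩, ?_⟩
    simp only [switch2_eq_neg, add_sub_cancel_right, switchGraph2_eq_neg, ← e,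
      (switch1_mem_graph hl hθ).2]
    ext
    · simp [e]
    · rfl

/-! ### The feedback law along the extremals -/

lemma switchGraph1_neg_self {l : ℝ} (hl : 0 < l) : switchGraph1 l (-l) = 0 := by
  have hr : √(l ^ 2 + 1 - 2 * -l) = l + 1 := by
    rw [show l ^ 2 + 1 - 2 * -l = (l + 1) ^ 2 by ring]
    exact Real.sqrt_sq (by linarith)
  rw [switchGraph1, hr, show l ^ 2 - -l - l * (l + 1) = 0 by ring]
  simp

/-- Since `switchGraph1` vanishes at -l, clamping the argument merges the three cases; oddness and
continuity can be read off. -/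
lemma switchOrdinate_eq {l : ℝ} (hl : 0 < l) (x : ℝ) :
    switchOrdinate l x = switchGraph1 l (min x (-l)) - switchGraph1 l (min (-x) (-l)) := by
  have h0 := switchGraph1_neg_self hl
  rw [switchOrdinate]
  split_ifs with h1 h2
  · rw [min_eq_left h1, min_eq_right (by linarith), h0, sub_zero]
  · rw [min_eq_right (by linarith), min_eq_left (by linarith), h0, switchGraph2_eq_neg, zero_sub]
  · rw [min_eq_right (by linarith), min_eq_right (by linarith), h0, sub_zero]

lemma switchOrdinate_neg {l : ℝ} (hl : 0 < l) (x : ℝ) :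
    switchOrdinate l (-x) = -switchOrdinate l x := by
  rw [switchOrdinate_eq hl, switchOrdinate_eq hl, neg_neg]
  ring

lemma continuous_switchOrdinate {l : ℝ} (hl : 0 < l) : Continuous (switchOrdinate l) := by
  have h : Continuous fun x => switchGraph1 l (min x (-l)) := by
    have hr : ∀ x : ℝ, √(l ^ 2 + 1 - 2 * min x (-l)) - l ≠ 0 := fun x => by
      have h1 : l < √(l ^ 2 + 1 - 2 * min x (-l)) :=
        Real.lt_sqrt_of_sq_lt (by linarith [min_le_right x (-l)])
      linarith
    have hc : Continuous fun x : ℝ => √(l ^ 2 + 1 - 2 * min x (-l)) := by fun_prop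
    unfold switchGraph1
    refine (continuous_const.mul (hc.div (hc.sub continuous_const) hr)).mul ?_
    fun_prop
  have e : switchOrdinate l =
      fun x => switchGraph1 l (min x (-l)) - switchGraph1 l (min (-x) (-l)) :=
    funext (switchOrdinate_eq hl)
  rw [e]
  exact h.sub (h.comp continuous_neg)

lemma switchOrdinate_of_abs_le {l : ℝ} (hl : 0 < l) {x : ℝ} (hx : |x| ≤ l) :
    switchOrdinate l x = 0 := by
  obtain ⟨h1, h2⟩ := abs_le.1 hx
  rw [switchOrdinate_eq hl, min_eq_right h1, min_eq_right (by linarith), sub_self]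

lemma switchOrdinate_switch1 {l : ℝ} (hl : 0 < l) {θ : ℝ} (hθ : θ ∈ Ioo (π / 2) π) :
    switchOrdinate l (switch1 l θ).1 = (switch1 l θ).2 := by
  obtain ⟨h1, h2⟩ := switch1_mem_graph hl hθ
  rw [switchOrdinate, if_pos h1.le, h2]

lemma switchOrdinate_pos {l : ℝ} (hl : 0 < l) {x : ℝ} (hx : x < -l) : 0 < switchOrdinate l x := by
  obtain ⟨θ, hθ, rfl⟩ := exists_switch1_fst_eq hl hx
  rw [switchOrdinate_switch1 hl hθ]
  have h1 := mul_pos hl (sin_pos_of_mem hθ)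
  have h2 := neg_tan_pos hθ
  simp only [switch1]
  linarith

lemma abs_fst_gt_of_mem_exterior {l : ℝ} {p : ℝ × ℝ} (hp : p ∈ exterior l) (h2 : p.2 = 0) :
    l < |p.1| := by
  have hp' : l ^ 2 < p.1 ^ 2 + p.2 ^ 2 := hp
  rw [h2] at hp'
  exact lt_of_pow_lt_pow_left₀ 2 (abs_nonneg _) (by rw [sq_abs]; linarith)

/-- Outside the disc, the zero set of `x₂ - s(x₁)` consists of switching points. -/
lemma exists_switch_of_eq_switchOrdinate {l : ℝ} (hl : 0 < l) {p : ℝ × ℝ} (hp : p ∈ exterior l)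
    (h : p.2 = switchOrdinate l p.1) :
    ∃ θ ∈ Ioo (π / 2) π, p = extremal l θ (-tan θ) ∨ p = extremal l (θ + π) (-tan θ) := by
  rcases le_or_gt |p.1| l with habs | habs
  · rw [switchOrdinate_of_abs_le hl habs] at h
    exact absurd habs (not_le.2 (abs_fst_gt_of_mem_exterior hp h))
  · rcases lt_abs.1 habs with hr | hr
    · obtain ⟨θ, hθ, e⟩ := exists_switch1_fst_eq hl (neg_lt_neg hr)
      refine ⟨θ, hθ, .inr ?_⟩
      have h2 := switchOrdinate_switch1 hl hθ
      rw [e, switchOrdinate_neg hl, ← h] at h2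
      rw [extremal_add_pi, extremal_neg_tan hθ]
      ext
      · simp [e]
      · simp [← h2]
    · obtain ⟨θ, hθ, e⟩ := exists_switch1_fst_eq hl (x := p.1) (by linarith)
      refine ⟨θ, hθ, .inl ?_⟩
      have h2 := switchOrdinate_switch1 hl hθ
      rw [e, ← h] at h2
      rw [extremal_neg_tan hθ]
      ext
      · exact e.symm
      · exact h2

lemma pos_of_forall_ne_zero {f : ℝ → ℝ} (hf : Continuous f) {a b : ℝ}
    (h : ∀ t ∈ uIcc a b, f t ≠ 0) (ha : 0 < f a) : 0 < f b := by
  by_contra! hb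
  obtain ⟨t, ht, h0⟩ := intermediate_value_uIcc (hf.continuousOn (s := uIcc a b))
    (mem_uIcc.2 (.inr ⟨hb, ha.le⟩) : (0 : ℝ) ∈ uIcc (f a) (f b))
  exact h t ht h0

/-- Height of the extremal above the switching lines. -/
noncomputable def heightAlong (l θ τ : ℝ) : ℝ :=
  (extremal l θ τ).2 - switchOrdinate l (extremal l θ τ).1

lemma continuous_heightAlong {l : ℝ} (hl : 0 < l) (θ : ℝ) : Continuous (heightAlong l θ) :=
  (continuous_extremal l θ).snd.sub
    ((continuous_switchOrdinate hl).comp (continuous_extremal l θ).fst)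

/-- A zero of the height is a switching point of some extremal. As extremals do not meet, that
extremal is the present one and τ is its switching time. -/
lemma switchFun_eq_zero_of_heightAlong {l : ℝ} (hl : 0 < l) (hl1 : l ≤ 1) {θ τ : ℝ} (hτ : 0 < τ)
    (h : heightAlong l θ τ = 0) : switchFun θ τ = 0 := by
  obtain ⟨φ, hφ, e⟩ := exists_switch_of_eq_switchOrdinate hl (extremal_mem_exterior hl hl1 θ hτ)
    (sub_eq_zero.1 h)
  have h0 : switchFun φ (-tan φ) = 0 := by
    rw [switchFun_eq_cos_mul (cos_neg_of_mem hφ).ne]; simp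
  rcases e with e | e
  · obtain ⟨h1, h2, h3⟩ := extremal_injective hl hl1 hτ.le (neg_tan_pos hφ).le e
    rw [switchFun, h2, h3, h1]
    exact h0
  · obtain ⟨h1, h2, h3⟩ := extremal_injective hl hl1 hτ.le (neg_tan_pos hφ).le e
    have h4 := switchFun_add_pi φ (-tan φ)
    rw [h0, neg_zero] at h4
    rw [switchFun, h2, h3, h1]
    exact h4

lemma heightAlong_pos {l : ℝ} (hl : 0 < l) (hl1 : l ≤ 1) {θ τ : ℝ} (hθ : θ ∈ Ico 0 π)
    (hτ : 0 < τ) (h : 0 < switchFun θ τ) : 0 < heightAlong l θ τ := by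
  have hsin : 0 ≤ sin θ := sin_nonneg_of_nonneg_of_le_pi hθ.1 hθ.2.le
  have hpos : ∀ s, 0 < s → s ≤ τ → 0 < switchFun θ s := by
    intro s hs hsτ
    -- σ is affine, so on (0, τ] it interpolates between sin θ ≥ 0 and σ(τ) > 0.
    have e : τ * switchFun θ s = (τ - s) * sin θ + s * switchFun θ τ := by
      simp only [switchFun]; ring
    have : 0 < τ * switchFun θ s := by
      rw [e]
      exact add_pos_of_nonneg_of_pos (mul_nonneg (by linarith) hsin) (mul_pos hs h)
    exact pos_of_mul_pos_right this hτ.le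
  have hne : ∀ s, 0 < s → s ≤ τ → heightAlong l θ s ≠ 0 := fun s hs hsτ h0 =>
    (hpos s hs hsτ).ne' (switchFun_eq_zero_of_heightAlong hl hl1 hs h0)
  rcases hθ.1.eq_or_lt with h0 | h0
  · subst h0
    have hs : 0 < min τ l := lt_min hτ hl
    -- For θ = 0 the height vanishes at time 0, so the sample is taken at min τ l, where the arc is
    -- still above [-l, l].
    refine pos_of_forall_ne_zero (continuous_heightAlong hl 0) (a := min τ l) (fun t ht => ?_) ?_
    · rw [uIcc_of_le (min_le_left _ _)] at ht
      exact hne t (hs.trans_le ht.1) ht.2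
    · rw [heightAlong, ← arcRight_eq_extremal hs.le, switchOrdinate_of_abs_le hl]
      · simpa [arcRight] using ⟨hτ, hl⟩
      · have h1 : min τ l ^ 2 ≤ l ^ 2 := pow_le_pow_left₀ hs.le (min_le_right _ _) 2
        simp only [arcRight]
        rw [abs_le]
        constructor <;> nlinarith [sq_nonneg (min τ l)]
  · have hsin' : 0 < sin θ := sin_pos_of_pos_of_lt_pi h0 hθ.2
    have h1 : 0 < heightAlong l θ 0 := by
      rw [heightAlong, extremal_zero, switchOrdinate_of_abs_le hl]
      · simpa using mul_pos hl hsin'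
      · simp only [abs_mul, abs_of_pos hl]
        exact mul_le_of_le_one_right hl.le (abs_cos_le_one θ)
    refine pos_of_forall_ne_zero (continuous_heightAlong hl θ) (a := 0) (fun t ht => ?_) h1
    rw [uIcc_of_le hτ.le] at ht
    rcases ht.1.eq_or_lt with e | e
    · rw [← e]; exact h1.ne'
    · exact hne t e ht.2

lemma heightAlong_neg {l : ℝ} (hl : 0 < l) (hl1 : l ≤ 1) {θ τ : ℝ} (hθ : θ ∈ Ioo (π / 2) π)
    (h : -tan θ < τ) : heightAlong l θ τ < 0 := by
  have hcos := cos_neg_of_mem hθ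
  have htan := neg_tan_pos hθ
  have hsin := mul_pos hl (sin_pos_of_mem hθ)
  have hne : ∀ s, -tan θ < s → heightAlong l θ s ≠ 0 := fun s hs h0 => by
    have h1 := switchFun_eq_zero_of_heightAlong hl hl1 (htan.trans hs) h0
    rw [switchFun_eq_cos_mul hcos.ne] at h1
    have h2 := (mul_eq_zero.1 h1).resolve_left hcos.ne
    linarith
  -- The time at which the arc after the switch meets the x₁-axis. There x₁ < -l, where the
  -- switching ordinate is positive, which supplies the negative sample.
  set σ := l * sin θ - 2 * tan θ with hσ_def
  have hσ : -tan θ < σ := by linarith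
  have hx2 : (extremal l θ σ).2 = 0 := by
    rw [extremal_eq_after_switch hθ hσ.le]
    simp [hσ_def]
  have hx1 : (extremal l θ σ).1 < -l := by
    have h1 := parabola_after_switch (l := l) hθ hσ.le
    rw [hx2] at h1
    have h2 : 2 * l * sin θ ^ 2 / cos θ ≤ 0 :=
      div_nonpos_of_nonneg_of_nonpos (by positivity) hcos.le
    have h3 := abs_fst_gt_of_mem_exterior
      (extremal_mem_exterior hl hl1 θ (htan.trans hσ)) hx2
    have h4 : (extremal l θ σ).1 < 0 := by
      rw [h1]
      nlinarith [mul_neg_of_pos_of_neg hl hcos, sq_nonneg (l * sin θ), sq_nonneg (tan θ)]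
    rw [abs_of_neg h4] at h3
    linarith
  have hσneg : 0 < -heightAlong l θ σ := by
    rw [heightAlong, hx2]
    linarith [switchOrdinate_pos hl hx1]
  have := pos_of_forall_ne_zero (continuous_heightAlong hl θ).neg (a := σ) (b := τ)
    (fun t ht => neg_ne_zero.2 (hne t ?_)) hσneg
  · exact neg_pos.1 this
  · exact lt_of_lt_of_le (lt_min hσ h) ht.1

lemma sign_heightAlong_of_mem_Ico {l : ℝ} (hl : 0 < l) (hl1 : l ≤ 1) {θ τ : ℝ}
    (hθ : θ ∈ Ico 0 π) (hτ : 0 < τ) :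
    Real.sign (heightAlong l θ τ) = Real.sign (switchFun θ τ) := by
  rcases lt_or_ge 0 (switchFun θ τ) with h | h
  · rw [Real.sign_of_pos h, Real.sign_of_pos (heightAlong_pos hl hl1 hθ hτ h)]
  · have hθ0 : 0 < θ := by
      refine lt_of_le_of_ne hθ.1 fun e => ?_
      subst e
      simp [switchFun] at h
      linarith
    have hc : π / 2 < θ := by
      by_contra! hc
      exact absurd (switchFun_pos ⟨hθ0, hθ.2⟩ hτ.le fun hc' => absurd hc (not_le.2 hc'))
        (not_lt.2 h)
    have hcos := cos_neg_of_mem ⟨hc, hθ.2⟩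
    have hle : -tan θ ≤ τ := by
      by_contra! hlt
      exact absurd (switchFun_pos ⟨hθ0, hθ.2⟩ hτ.le fun _ => hlt) (not_lt.2 h)
    rcases hle.eq_or_lt with e | e
    · rw [← e, heightAlong, extremal_neg_tan ⟨hc, hθ.2⟩, switchOrdinate_switch1 hl ⟨hc, hθ.2⟩,
        switchFun_eq_cos_mul hcos.ne]
      simp
    · have h' : switchFun θ τ < 0 := by
        rw [switchFun_eq_cos_mul hcos.ne]
        exact mul_neg_of_neg_of_pos hcos (by linarith)
      rw [Real.sign_of_neg h', Real.sign_of_neg (heightAlong_neg hl hl1 ⟨hc, hθ.2⟩ e)]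

/-- The feedback law prescribes the extremal control along every extremal. -/
lemma feedback_extremal {l : ℝ} (hl : 0 < l) (hl1 : l ≤ 1) {θ τ : ℝ}
    (hθ : θ ∈ Ico 0 (2 * π)) (hτ : 0 < τ) :
    feedback l (extremal l θ τ) = -Real.sign (switchFun θ τ) := by
  rw [feedback, neg_inj]
  rcases lt_or_ge θ π with h | h
  · exact sign_heightAlong_of_mem_Ico hl hl1 ⟨hθ.1, h⟩ hτ
  · have h1 := sign_heightAlong_of_mem_Ico hl hl1 (θ := θ - π)
      ⟨by linarith, by linarith [hθ.2]⟩ hτ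
    have h2 := switchFun_add_pi (θ - π) τ
    rw [sub_add_cancel] at h2
    rw [h2, Real.sign_neg, ← h1, ← Real.sign_neg, heightAlong, extremal_eq_neg_sub_pi l θ]
    congr 1
    simp only [Prod.fst_neg, Prod.snd_neg, switchOrdinate_neg hl]
    ring

/-! ### Dynamic programming -/

lemma IsTrajectory.congr {u : ℝ → ℝ} {x y : ℝ → ℝ × ℝ} {x₀ : ℝ × ℝ} {T : ℝ}
    (h : IsTrajectory u x x₀ T) (hxy : ∀ t ∈ Icc 0 T, y t = x t) : IsTrajectory u y x₀ T where
  nonneg := h.nonneg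
  measurable := h.measurable
  bounded := h.bounded
  fst_eq t ht := by
    rw [hxy t ht, h.fst_eq t ht]
    congr 1
    refine intervalIntegral.integral_congr fun s hs => ?_
    rw [uIcc_of_le ht.1] at hs
    simp only [vectorField, hxy s ⟨hs.1, hs.2.trans ht.2⟩]
  snd_eq t ht := by
    rw [hxy t ht]
    exact h.snd_eq t ht

lemma isLeast_value_of_mem_union {l : ℝ} (hl : 0 < l) (hl1 : l ≤ 1) {p : ℝ × ℝ}
    (hp : p ∈ exterior l ∪ circleTarget l) : IsLeast (reachTimes l p) (value l p) := by
  rcases hp with h | h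
  · exact (isLeast_value hl hl1 h).2
  · rw [value_of_mem_circleTarget h]
    refine ⟨⟨_, _, isTrajectory_const p (c := 0) (by norm_num) le_rfl, ?_⟩,
      fun T hT => reachTimes_nonneg hT⟩
    simpa using h

lemma value_nonneg_of_mem_union {l : ℝ} (hl : 0 < l) (hl1 : l ≤ 1) {p : ℝ × ℝ}
    (hp : p ∈ exterior l ∪ circleTarget l) : 0 ≤ value l p :=
  reachTimes_nonneg (isLeast_value_of_mem_union hl hl1 hp).1

/-- A trajectory can be continued optimally to the target. -/
lemma IsTrajectory.continue_optimally {l : ℝ} (hl : 0 < l) (hl1 : l ≤ 1) {u : ℝ → ℝ}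
    {x : ℝ → ℝ × ℝ} {x₀ : ℝ × ℝ} {T : ℝ} (h : IsTrajectory u x x₀ T)
    (hx : x T ∈ exterior l ∪ circleTarget l) :
    ∃ v y, IsTrajectory v y x₀ (T + value l (x T)) ∧ (∀ t ∈ Icc 0 T, v t = u t ∧ y t = x t) ∧
      y (T + value l (x T)) ∈ disc l := by
  have hleast := isLeast_value_of_mem_union hl hl1 hx
  have hnn := value_nonneg_of_mem_union hl hl1 hx
  obtain ⟨v, y, hy, hc⟩ := hleast.1
  refine ⟨_, _, h.concat hy, fun t ht => ⟨if_pos ht.2, if_pos ht.2⟩, ?_⟩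
  split_ifs with hle
  · have h0 : value l (x T) = 0 := by linarith
    rw [h0, hy.initial] at hc
    rw [h0, add_zero]
    exact mem_disc_of_mem_circleTarget hc
  · rw [add_sub_cancel_left]
    exact mem_disc_of_mem_circleTarget hc

lemma IsTrajectory.value_le {l : ℝ} (hl : 0 < l) (hl1 : l ≤ 1) {u : ℝ → ℝ}
    {x : ℝ → ℝ × ℝ} {x₀ : ℝ × ℝ} {T : ℝ} (h : IsTrajectory u x x₀ T) (h0 : x₀ ∈ exterior l)
    (hx : x T ∈ exterior l ∪ circleTarget l) : value l x₀ ≤ T + value l (x T) := by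
  obtain ⟨v, y, hy, -, hd⟩ := h.continue_optimally hl hl1 hx
  exact value_le_of_mem_disc hl hl1 h0 hy hd

/-! ### The value function along trajectories outside the disc -/

section Exterior

variable {l : ℝ} {u : ℝ → ℝ} {x : ℝ → ℝ × ℝ} {x₀ : ℝ × ℝ} {T : ℝ}

lemma IsTrajectory.mem_union (h : IsTrajectory u x x₀ T) (h0 : x₀ ∈ exterior l)
    (hext : ∀ t ∈ Ico 0 T, x t ∈ exterior l) {t : ℝ} (ht : t ∈ Icc 0 T) :
    x t ∈ exterior l ∪ circleTarget l := by
  rcases ht.2.lt_or_eq with hlt | rfl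
  · exact .inl (hext t ⟨ht.1, hlt⟩)
  rcases ht.1.eq_or_lt with rfl | hpos
  · rw [h.initial]; exact .inl h0
  have hc : Tendsto x (𝓝[<] t) (𝓝 (x t)) := by
    have := (h.continuousOn t ht).mono Ioo_subset_Icc_self
    rwa [ContinuousWithinAt, nhdsWithin_Ioo_eq_nhdsLT hpos] at this
  have hn : Continuous fun p : ℝ × ℝ => p.1 ^ 2 + p.2 ^ 2 := by fun_prop
  have hle : l ^ 2 ≤ (x t).1 ^ 2 + (x t).2 ^ 2 := by
    refine ge_of_tendsto ((hn.tendsto (x t)).comp hc) ?_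
    filter_upwards [Ioo_mem_nhdsLT hpos] with s hs
    exact le_of_lt (hext s ⟨hs.1.le, hs.2⟩)
  rcases hle.lt_or_eq with hlt | heq
  · exact .inl hlt
  · exact .inr heq.symm

/-- Principle of optimality: following the trajectory from s to t and then continuing optimally
cannot beat the value at time s. -/
lemma IsTrajectory.value_add_monotoneOn (hl : 0 < l) (hl1 : l ≤ 1) (h : IsTrajectory u x x₀ T)
    (h0 : x₀ ∈ exterior l) (hext : ∀ t ∈ Ico 0 T, x t ∈ exterior l) :
    MonotoneOn (fun t => value l (x t) + t) (Icc 0 T) := by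
  intro s hs t ht hst
  rcases hst.eq_or_lt with rfl | hlt
  · exact le_rfl
  have h1 := (h.restrict ht).shift (a := s) ⟨hs.1, hst⟩
  have h2 := h1.value_le hl hl1 (hext s ⟨hs.1, hlt.trans_le ht.2⟩)
    (by rw [sub_add_cancel]; exact h.mem_union h0 hext ht)
  rw [sub_add_cancel] at h2
  simp only
  linarith

/-- Lower semicontinuity of the value function along trajectories. -/
lemma IsTrajectory.value_add_le_of_forall_lt (hl : 0 < l) (hl1 : l ≤ 1)
    (h : IsTrajectory u x x₀ T) (h0 : x₀ ∈ exterior l)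
    (hext : ∀ t ∈ Ico 0 T, x t ∈ exterior l) {t : ℝ} (ht : t ∈ Ioc 0 T) {M : ℝ}
    (hM : ∀ s ∈ Ico 0 t, value l (x s) + s ≤ M) : value l (x t) + t ≤ M := by
  have htI : t ∈ Icc 0 T := ⟨ht.1.le, ht.2⟩
  have hxs : ∀ s ∈ Ioo 0 t, x s ∈ exterior l := fun s hs => hext s ⟨hs.1.le, hs.2.trans_le ht.2⟩
  have hMt : 0 ≤ M - t := by
    have hc : Tendsto (fun s => M - s) (𝓝[<] t) (𝓝 (M - t)) :=
      ((continuous_const.sub continuous_id).tendsto t).mono_left nhdsWithin_le_nhds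
    refine ge_of_tendsto hc ?_
    filter_upwards [Ioo_mem_nhdsLT ht.1] with s hs
    linarith [hM s ⟨hs.1.le, hs.2⟩, (isLeast_value hl hl1 (hxs s hs)).1]
  rcases h.mem_union h0 hext htI with hx | hx
  · suffices value l (x t) ≤ M - t by linarith
    -- The support inequalities at the times M - s pass to the limit s → t; no continuity of the
    -- value is needed.
    refine value_le_of_supportGap_nonpos hl hl1 hx hMt fun θ => ?_
    have hcx : Tendsto x (𝓝[<] t) (𝓝 (x t)) := by
      have := (h.continuousOn t htI).mono
        (Ioo_subset_Icc_self.trans (Icc_subset_Icc le_rfl ht.2))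
      rwa [ContinuousWithinAt, nhdsWithin_Ioo_eq_nhdsLT ht.1] at this
    have hcs : Tendsto (fun s => M - s) (𝓝[<] t) (𝓝 (M - t)) :=
      ((continuous_const.sub continuous_id).tendsto t).mono_left nhdsWithin_le_nhds
    have hcg : ContinuousAt (fun q : ℝ × ℝ × ℝ => supportGap l q.1 θ q.2) (M - t, x t) :=
      (hasFDerivAt_supportGap l θ (x t)).continuousAt
    refine le_of_tendsto (hcg.tendsto.comp (hcs.prodMk_nhds hcx)) ?_
    filter_upwards [Ioo_mem_nhdsLT ht.1] with s hs
    exact supportGap_nonpos_of_value_le hl hl1 (hxs s hs)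
      (by linarith [hM s ⟨hs.1.le, hs.2⟩]) θ
  · rw [value_of_mem_circleTarget hx]
    linarith

lemma IsTrajectory.abs_snd_sub_le (h : IsTrajectory u x x₀ T) {s t : ℝ} (hs : s ∈ Icc 0 T)
    (ht : t ∈ Icc 0 T) : |(x s).2 - (x t).2| ≤ |s - t| := by
  rw [h.snd_sub ht hs]
  have := intervalIntegral.norm_integral_le_of_norm_le_const (f := u) (a := t) (b := s) (C := 1)
    fun r hr => h.abs_le_one (ordConnected_Icc.uIcc_subset ht hs (uIoc_subset_uIcc hr))
  simpa using this

lemma IsTrajectory.abs_fst_sub_le (h : IsTrajectory u x x₀ T) {s t : ℝ} (hs : s ∈ Icc 0 T)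
    (ht : t ∈ Icc 0 T) : |(x s).1 - (x t).1 - (s - t) * (x t).2| ≤ |s - t| * |s - t| := by
  have hi : IntervalIntegrable (fun r => (x r).2) volume t s :=
    (h.continuousOn_snd.mono (ordConnected_Icc.uIcc_subset ht hs)).intervalIntegrable
  have e : (x s).1 - (x t).1 - (s - t) * (x t).2 = ∫ r in t..s, ((x r).2 - (x t).2) := by
    rw [intervalIntegral.integral_sub hi intervalIntegrable_const, h.fst_sub ht hs]
    simp
  rw [e]
  refine intervalIntegral.norm_integral_le_of_norm_le_const (E := ℝ)
    (f := fun r => (x r).2 - (x t).2) fun r hr => ?_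
  have hr' := uIoc_subset_uIcc hr
  refine (h.abs_snd_sub_le (ordConnected_Icc.uIcc_subset ht hs hr') ht).trans ?_
  exact abs_sub_left_of_mem_uIcc hr'

lemma IsTrajectory.hasDerivWithinAt_fst (h : IsTrajectory u x x₀ T) {t : ℝ} (ht : t ∈ Ico 0 T) :
    HasDerivWithinAt (fun s => (x s).1) (x t).2 (Ici t) t := by
  rw [hasDerivWithinAt_iff_isLittleO, Asymptotics.isLittleO_iff]
  intro c hc
  have h1 : ∀ᶠ s in 𝓝[≥] t, s < min T (t + c) :=
    mem_nhdsWithin_of_mem_nhds (Iio_mem_nhds (lt_min ht.2 (by linarith)))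
  filter_upwards [h1, self_mem_nhdsWithin] with s hs hts
  have hts' : t ≤ s := hts
  have hsT : s ∈ Icc 0 T := ⟨ht.1.trans hts', (hs.trans_le (min_le_left _ _)).le⟩
  rw [Real.norm_eq_abs, Real.norm_eq_abs, smul_eq_mul]
  refine (h.abs_fst_sub_le hsT ⟨ht.1, ht.2.le⟩).trans ?_
  refine mul_le_mul_of_nonneg_right ?_ (abs_nonneg _)
  rw [abs_of_nonneg (sub_nonneg.2 hts')]
  linarith [hs.trans_le (min_le_right T (t + c))]

/-- For a measurable control x₂ need not have a one-sided derivative at a given time; this linear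
bound suffices at switching points. -/
lemma IsTrajectory.isBigO_sub (h : IsTrajectory u x x₀ T) {t : ℝ} (ht : t ∈ Ico 0 T) :
    (fun s => x s - x t) =O[𝓝[≥] t] fun s => s - t := by
  refine Asymptotics.IsBigO.prod_left (f' := fun s => (x s).1 - (x t).1)
    (g' := fun s => (x s).2 - (x t).2) ?_ ?_
  · exact (h.hasDerivWithinAt_fst ht).differentiableWithinAt.isBigO_sub
  · refine Asymptotics.IsBigO.of_bound 1 ?_
    have h1 : ∀ᶠ s in 𝓝[≥] t, s < T := mem_nhdsWithin_of_mem_nhds (Iio_mem_nhds ht.2)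
    filter_upwards [h1, self_mem_nhdsWithin] with s hs hts
    rw [one_mul]
    exact h.abs_snd_sub_le ⟨ht.1.trans hts, hs.le⟩ ⟨ht.1, ht.2.le⟩

/-- A trajectory obeying the feedback law loses no time, to first order. -/
lemma IsTrajectory.hasDerivWithinAt_value_add (hl : 0 < l) (hl1 : l ≤ 1)
    (h : IsTrajectory u x x₀ T) (hext : ∀ t ∈ Ico 0 T, x t ∈ exterior l)
    (hu : ∀ᵐ t ∂(volume.restrict (Icc 0 T)), u t = feedback l (x t)) {t : ℝ} (ht : t ∈ Ico 0 T) :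
    HasDerivWithinAt (fun s => value l (x s) + s) 0 (Ici t) t := by
  obtain ⟨θ, hθ, τ, hτ, hxt⟩ := exists_extremal_mem_Ico hl (hext t ht)
  have htI : t ∈ Icc 0 T := ⟨ht.1, ht.2.le⟩
  -- On a switching line λ₂ = 0, so the derivative of V along the motion is λ₁x₂ = -1 whatever the
  -- control does. Off the lines the feedback is locally constant and the motion follows the
  -- extremal for a short time; this case includes the two exceptional arcs θ = 0 and θ = π.
  rcases eq_or_ne (switchFun θ τ) 0 with hw | hw
  · have hsin : sin θ ≠ 0 := fun hs => by
      have hc : cos θ ≠ 0 := fun hc => by simpa [hs, hc] using sin_sq_add_cos_sq θ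
      rw [switchFun, hs, zero_add] at hw
      exact (mul_ne_zero hτ.ne' hc) hw
    have hV := hasFDerivAt_value_extremal hl hl1 hsin hτ
    have hham := optHamiltonian_extremal hl hl1 hsin τ
    have hl2 : (charCostate l θ τ).2 = 0 := by rw [charCostate_snd, hw, mul_zero]
    rw [← hxt] at hV hham
    rw [hl2, zero_smul, add_zero] at hV
    rw [optHamiltonian, hl2, abs_zero, sub_zero] at hham
    have hx : Tendsto x (𝓝[≥] t) (𝓝 (x t)) := by
      have := (h.continuousOn t htI).mono (Icc_subset_Icc_left ht.1)
      rwa [ContinuousWithinAt, nhdsWithin_Icc_eq_nhdsGE ht.2] at this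
    have h1 := (hV.isLittleO.comp_tendsto hx).trans_isBigO (h.isBigO_sub ht)
    have h2 := (hasDerivWithinAt_iff_isLittleO.1
      ((h.hasDerivWithinAt_fst ht).const_mul (charCostate l θ τ).1))
    rw [hasDerivWithinAt_iff_isLittleO]
    refine (h1.add h2).congr_left fun s => ?_
    simp
    linear_combination (t - s) * hham
  · have hev : ∀ᶠ r in 𝓝[≥] (0 : ℝ), Real.sign (switchFun θ (τ - r)) =
        Real.sign (switchFun θ τ) ∧
        Real.sign ((x (t + r)).2 - switchOrdinate l (x (t + r)).1) =
          Real.sign (switchFun θ τ) := by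
      have hf : feedback l (x t) = -Real.sign (switchFun θ τ) := by
        rw [hxt]; exact feedback_extremal hl hl1 hθ hτ
      rw [feedback, neg_inj] at hf
      have hne : (x t).2 - switchOrdinate l (x t).1 ≠ 0 := fun h0 => by
        rw [h0, Real.sign_zero, eq_comm, Real.sign_eq_zero_iff] at hf
        exact hw hf
      have key : ∀ g : ℝ → ℝ, Tendsto g (𝓝[≥] 0) (𝓝 (g 0)) → g 0 ≠ 0 →
          ∀ᶠ r in 𝓝[≥] (0 : ℝ), Real.sign (g r) = Real.sign (g 0) := by
        intro g hg h0
        rcases lt_or_gt_of_ne h0 with hn | hp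
        · filter_upwards [hg.eventually (gt_mem_nhds hn)] with r hr
          rw [Real.sign_of_neg hr, Real.sign_of_neg hn]
        · filter_upwards [hg.eventually (lt_mem_nhds hp)] with r hr
          rw [Real.sign_of_pos hr, Real.sign_of_pos hp]
      have k1 := key (fun r => switchFun θ (τ - r))
        (((continuous_switchFun θ).comp (continuous_const.sub continuous_id)).tendsto
          0 |>.mono_left nhdsWithin_le_nhds) (by simpa using hw)
      have hshift := (h.shift htI).continuousOn 0 ⟨le_rfl, by linarith [ht.2]⟩
      rw [ContinuousWithinAt, nhdsWithin_Icc_eq_nhdsGE (by linarith [ht.2])] at hshift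
      have hG : Continuous fun p : ℝ × ℝ => p.2 - switchOrdinate l p.1 :=
        continuous_snd.sub ((continuous_switchOrdinate hl).comp continuous_fst)
      have k2 := key (fun r => (x (r + t)).2 - switchOrdinate l (x (r + t)).1)
        ((hG.tendsto _).comp hshift) (by simpa using hne)
      filter_upwards [k1, k2] with r h1 h2
      simp only [sub_zero, zero_add] at h1 h2
      rw [add_comm t r]
      exact ⟨h1, h2.trans hf⟩
    obtain ⟨δ, hδ, hδs⟩ := mem_nhdsGE_iff_exists_Icc_subset.1 hev
    set ρ := min δ (min τ (T - t)) with hρ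
    have hρ0 : 0 < ρ := lt_min hδ (lt_min hτ (by linarith [ht.2]))
    have hρτ : ρ ≤ τ := (min_le_right _ _).trans (min_le_left _ _)
    have hρT : ρ ≤ T - t := (min_le_right _ _).trans (min_le_right _ _)
    have hy := (h.shift htI).restrict (S := ρ) ⟨hρ0.le, hρT⟩
    have hz := (isTrajectory_extremal l θ hτ.le).restrict (S := ρ) ⟨hρ0.le, hρτ⟩
    rw [← hxt] at hz
    have hae : ∀ᵐ r ∂(volume.restrict (Icc 0 ρ)), u (r + t) =
        -Real.sign (switchFun θ (τ - r)) := by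
      have h1 := (measurePreserving_add_right volume t).quasiMeasurePreserving.ae
        ((ae_restrict_iff' measurableSet_Icc).1 hu)
      rw [ae_restrict_iff' measurableSet_Icc]
      filter_upwards [h1] with r hr hrI
      obtain ⟨e1, e2⟩ := hδs ⟨hrI.1, hrI.2.trans (min_le_left _ _)⟩
      rw [hr ⟨by linarith [ht.1, hrI.1], by linarith [hrI.2]⟩, feedback, add_comm r t, e2, e1]
    have heq := hy.eqOn_of_ae_eq hz hae
    refine (hasDerivWithinAt_const t (Ici t) (value l (x t) + t)).congr_of_eventuallyEq_of_mem
      ?_ self_mem_Ici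
    have h1 : ∀ᶠ s in 𝓝[≥] t, s < t + ρ :=
      mem_nhdsWithin_of_mem_nhds (Iio_mem_nhds (by linarith))
    filter_upwards [h1, self_mem_nhdsWithin] with s hs hts
    have hts' : t ≤ s := hts
    have e := heq (s - t) ⟨by linarith, by linarith⟩
    rw [sub_add_cancel] at e
    rw [e, hxt, value_extremal hl hl1 θ (by linarith), value_extremal hl hl1 θ hτ.le]
    ring

lemma IsTrajectory.value_eq_of_feedback (hl : 0 < l) (hl1 : l ≤ 1) (h : IsTrajectory u x x₀ T)
    (h0 : x₀ ∈ exterior l) (hext : ∀ t ∈ Ico 0 T, x t ∈ exterior l)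
    (hu : ∀ᵐ t ∂(volume.restrict (Icc 0 T)), u t = feedback l (x t)) :
    value l (x T) = value l x₀ - T := by
  have hmono := h.value_add_monotoneOn hl hl1 h0 hext
  have hd := fun t (ht : t ∈ Ico 0 T) => h.hasDerivWithinAt_value_add hl hl1 hext hu ht
  have hc : ContinuousOn (fun t => value l (x t) + t) (Icc 0 T) := by
    intro t ht
    -- Monotonicity gives the upper bound from the left and lower semicontinuity the lower one.
    -- Continuity from the right comes from the right derivative.
    have hleft : ContinuousWithinAt (fun t => value l (x t) + t) (Icc 0 t) t := by
      rcases ht.1.eq_or_lt with e | hpos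
      · rw [← e, Icc_self]; exact continuousWithinAt_singleton
      rw [ContinuousWithinAt, tendsto_order]
      refine ⟨fun a ha => ?_, fun b hb => ?_⟩
      · have : ∃ s ∈ Ico 0 t, a < value l (x s) + s := by
          by_contra! hcon
          exact absurd (h.value_add_le_of_forall_lt hl hl1 h0 hext ⟨hpos, ht.2⟩ hcon)
            (not_le.2 ha)
        obtain ⟨s, hs, has⟩ := this
        filter_upwards [mem_nhdsWithin_of_mem_nhds (Ioi_mem_nhds hs.2), self_mem_nhdsWithin]
          with r hr hr'
        exact has.trans_le
          (hmono ⟨hs.1, hs.2.le.trans ht.2⟩ ⟨hr'.1, hr'.2.trans ht.2⟩ (le_of_lt hr))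
      · filter_upwards [self_mem_nhdsWithin] with r hr
        exact (hmono ⟨hr.1, hr.2.trans ht.2⟩ ht hr.2).trans_lt hb
    have hright : ContinuousWithinAt (fun t => value l (x t) + t) (Icc t T) t := by
      rcases ht.2.eq_or_lt with e | hlt
      · rw [← e, Icc_self]; exact continuousWithinAt_singleton
      · exact (hd t ⟨ht.1, hlt⟩).continuousWithinAt.mono Icc_subset_Ici_self
    have := hleft.union hright
    rwa [Icc_union_Icc_eq_Icc ht.1 ht.2] at this
  have := constant_of_has_deriv_right_zero hc hd T (right_mem_Icc.2 h.nonneg)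
  simp only [add_zero] at this
  rw [h.initial] at this
  linarith

/-- Continued optimally, the trajectory reaches the target in total time V(x₀), so rigidity makes it
the extremal, along which the feedback prescribes the control. -/
lemma IsTrajectory.feedback_of_value_eq (hl : 0 < l) (hl1 : l ≤ 1) (h : IsTrajectory u x x₀ T)
    (h0 : x₀ ∈ exterior l) (hext : ∀ t ∈ Ico 0 T, x t ∈ exterior l)
    (hv : value l (x T) = value l x₀ - T) :
    ∀ᵐ t ∂(volume.restrict (Icc 0 T)), u t = feedback l (x t) := by
  have hT := h.mem_union h0 hext (right_mem_Icc.2 h.nonneg)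
  have hnn := value_nonneg_of_mem_union hl hl1 hT
  obtain ⟨v, y, hy, hvu, hd⟩ := h.continue_optimally hl hl1 hT
  obtain ⟨θ, hθ, τ, hτ, rfl⟩ := exists_extremal_mem_Ico hl h0
  rw [value_extremal hl hl1 θ hτ.le] at hv
  have e : T + value l (x T) = τ := by linarith
  rw [e] at hy hd
  obtain ⟨hae, hst⟩ := hy.rigidity hl.le hd
  rw [ae_restrict_iff' measurableSet_Icc] at hae ⊢
  -- The end time may lie on the circle, where `feedback_extremal` says nothing; it is a null set.
  have hne : ∀ᵐ t : ℝ, t ≠ T := by simp [ae_iff]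
  filter_upwards [hae, hne] with t h1 h2 ht
  have htT : t < T := lt_of_le_of_ne ht.2 h2
  have htτ : t < τ := by linarith
  rw [← (hvu t ht).1, h1 ⟨ht.1, htτ.le⟩, ← (hvu t ht).2, hst t ⟨ht.1, htτ.le⟩,
    feedback_extremal hl hl1 hθ (sub_pos.2 htτ)]

end Exterior

/-! ### Covering of the exterior by the characteristics -/

lemma mem_usableAngles_or {θ : ℝ} (hθ : θ ∈ Ico 0 (2 * π)) :
    θ ∈ usableAngles ∨ θ = 0 ∨ θ = π := by
  rcases eq_or_ne θ 0 with h | h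
  · exact .inr (.inl h)
  rcases lt_trichotomy θ π with h1 | h1 | h1
  · exact .inl (.inl ⟨lt_of_le_of_ne hθ.1 h.symm, h1⟩)
  · exact .inr (.inr h1)
  · exact .inl (.inr ⟨h1, hθ.2⟩)

/-- The excluded arcs are the extremals of angle 0 and π, which separate from the others because sin
θ ≠ 0 on `usableAngles`. -/
lemma bijOn_charState {l : ℝ} (hl : 0 < l) (hl1 : l ≤ 1) :
    BijOn (fun q : ℝ × ℝ => charState l q.1 q.2) (usableAngles ×ˢ Ioi 0)
      (exterior l \ (arcRight l '' Ioi 0 ∪ arcLeft l '' Ioi 0)) := by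
  refine ⟨?_, ?_, ?_⟩
  · rintro ⟨θ, τ⟩ ⟨hθ, hτ⟩
    have hτ' : 0 < τ := hτ
    simp only [charState_eq_extremal hθ hτ'.le]
    have hsin := sin_ne_zero_of_mem hθ
    refine ⟨extremal_mem_exterior hl hl1 θ hτ', ?_⟩
    rintro (⟨s, hs, e⟩ | ⟨s, hs, e⟩)
    · rw [arcRight_eq_extremal (le_of_lt hs)] at e
      have := (extremal_injective hl hl1 (le_of_lt hs) hτ'.le e).2.2
      rw [sin_zero] at this
      exact hsin this.symm
    · rw [arcLeft_eq_extremal (le_of_lt hs)] at e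
      have := (extremal_injective hl hl1 (le_of_lt hs) hτ'.le e).2.2
      rw [sin_pi] at this
      exact hsin this.symm
  · rintro ⟨θ, τ⟩ ⟨hθ, hτ⟩ ⟨θ', τ'⟩ ⟨hθ', hτ'⟩ e
    have h1 : 0 < τ := hτ
    have h2 : 0 < τ' := hτ'
    simp only [charState_eq_extremal hθ h1.le, charState_eq_extremal hθ' h2.le] at e
    obtain ⟨e1, e2, e3⟩ := extremal_injective hl hl1 h1.le h2.le e
    exact Prod.ext (eq_of_cos_eq_of_sin_eq (usableAngles_subset hθ) (usableAngles_subset hθ')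
      e2 e3) e1
  · rintro p ⟨hp, hna⟩
    obtain ⟨θ, hθ, τ, hτ, rfl⟩ := exists_extremal_mem_Ico hl hp
    rcases mem_usableAngles_or hθ with h | rfl | rfl
    · exact ⟨(θ, τ), ⟨h, hτ⟩, charState_eq_extremal h hτ.le⟩
    · exact absurd (.inl ⟨τ, hτ, arcRight_eq_extremal hτ.le⟩) hna
    · exact absurd (.inr ⟨τ, hτ, arcLeft_eq_extremal hτ.le⟩) hna

lemma setOf_isLeast_eq {l : ℝ} (hl : 0 < l) (hl1 : l ≤ 1) {τ : ℝ} (hτ : 0 < τ) :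
    {x₀ ∈ exterior l | IsLeast (reachTimes l x₀) τ} =
      isochrone l τ ∪ {arcRight l τ, arcLeft l τ} := by
  ext p
  constructor
  · rintro ⟨hp, hleast⟩
    obtain ⟨θ, hθ, σ, hσ, rfl⟩ := exists_extremal_mem_Ico hl hp
    obtain rfl := (isLeast_extremal hl hl1 θ hσ.le).unique hleast
    rcases mem_usableAngles_or hθ with h | rfl | rfl
    · exact .inl ⟨θ, h, charState_eq_extremal h hσ.le⟩
    · exact .inr (.inl (arcRight_eq_extremal hσ.le).symm)
    · exact .inr (.inr (arcLeft_eq_extremal hσ.le).symm)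
  · have key : ∀ θ, extremal l θ τ ∈ {x₀ ∈ exterior l | IsLeast (reachTimes l x₀) τ} :=
      fun θ => ⟨extremal_mem_exterior hl hl1 θ hτ, isLeast_extremal hl hl1 θ hτ.le⟩
    rintro (⟨θ, hθ, rfl⟩ | rfl | rfl)
    · simp only [charState_eq_extremal hθ hτ.le]
      exact key θ
    · rw [arcRight_eq_extremal hτ.le]
      exact key 0
    · rw [arcLeft_eq_extremal hτ.le]
      exact key π

end DoubleIntegrator

/-! ### The optimal synthesis -/

theorem mainTheorem2 (l : ℝ) (hl : 0 < l) (hl1 : l ≤ 1) :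
    -- the usable part, its boundary, and the non-usable part of the terminal circle
    (UP l = circlePoint l '' usableAngles ∧ BUP l = {(-l, 0), (l, 0)} ∧ NUP l = ∅) ∧
    -- the characteristics emanating from the usable part, in closed form
    (∀ θ ∈ usableAngles, ∀ x p : ℝ → ℝ × ℝ, IsCharacteristic l θ x p ↔
      ∀ τ, 0 ≤ τ → x τ = charState l θ τ ∧ p τ = charCostate l θ τ) ∧
    -- they consist of parabolic arcs
    (∀ θ ∈ Ioo 0 π, ∀ τ, 0 ≤ τ → (π / 2 < θ → τ ≤ -tan θ) →
      (charState l θ τ).1 =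
        -(charState l θ τ).2 ^ 2 / 2 + l * cos θ + l ^ 2 * sin θ ^ 2 / 2) ∧
    (∀ θ ∈ Ioo (π / 2) π, ∀ τ, -tan θ ≤ τ →
      (charState l θ τ).1 = (charState l θ τ).2 ^ 2 / 2 + l * cos θ
        + 2 * l * sin θ ^ 2 / cos θ - l ^ 2 * sin θ ^ 2 / 2 - tan θ ^ 2) ∧
    (∀ θ ∈ Ioo π (2 * π), ∀ τ, 0 ≤ τ → (3 * π / 2 < θ → τ ≤ -tan θ) →
      (charState l θ τ).1 =
        (charState l θ τ).2 ^ 2 / 2 + l * cos θ - l ^ 2 * sin θ ^ 2 / 2) ∧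
    (∀ θ ∈ Ioo (3 * π / 2) (2 * π), ∀ τ, -tan θ ≤ τ →
      (charState l θ τ).1 = -(charState l θ τ).2 ^ 2 / 2 + l * cos θ
        + 2 * l * sin θ ^ 2 / cos θ + l ^ 2 * sin θ ^ 2 / 2 + tan θ ^ 2) ∧
    -- sign of the second costate: no switching for `θ ∈ (0, π/2] ∪ (π, 3π/2]`, exactly one
    -- switching, on the first or second switching line, for the other angles
    (∀ θ ∈ Ioc 0 (π / 2), ∀ τ, 0 ≤ τ → 0 < (charCostate l θ τ).2) ∧
    (∀ θ ∈ Ioc π (3 * π / 2), ∀ τ, 0 ≤ τ → (charCostate l θ τ).2 < 0) ∧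
    (∀ θ ∈ Ioo (π / 2) π, 0 < -tan θ ∧ charState l θ (-tan θ) = switch1 l θ ∧
      ∀ τ, 0 ≤ τ → Real.sign (charCostate l θ τ).2 = Real.sign (-tan θ - τ)) ∧
    (∀ θ ∈ Ioo (3 * π / 2) (2 * π), 0 < -tan θ ∧ charState l θ (-tan θ) = switch2 l θ ∧
      ∀ τ, 0 ≤ τ → Real.sign (charCostate l θ τ).2 = Real.sign (τ + tan θ)) ∧
    -- the switching lines are anchored at the points `(∓l, 0)` and are explicit graphs
    Tendsto (switch1 l) (𝓝[<] π) (𝓝 (-l, 0)) ∧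
    Tendsto (switch2 l) (𝓝[<] (2 * π)) (𝓝 (l, 0)) ∧
    switch1 l '' Ioo (π / 2) π = (fun x₁ => (x₁, switchGraph1 l x₁)) '' Iio (-l) ∧
    switch2 l '' Ioo (3 * π / 2) (2 * π) = (fun x₁ => (x₁, switchGraph2 l x₁)) '' Ioi l ∧
    -- the characteristics cover, once each, all states outside the target except for the two
    -- arcs that end at the points `(±l, 0)`
    BijOn (fun q : ℝ × ℝ => charState l q.1 q.2) (usableAngles ×ˢ Ioi 0)
      (exterior l \ (arcRight l '' Ioi 0 ∪ arcLeft l '' Ioi 0)) ∧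
    -- from every state outside the target the minimum time is attained, and the isochrones are
    (∀ x₀ ∈ exterior l, ∃ T, 0 < T ∧ IsLeast (reachTimes l x₀) T) ∧
    (∀ τ, 0 < τ → {x₀ ∈ exterior l | IsLeast (reachTimes l x₀) τ} =
      isochrone l τ ∪ {arcRight l τ, arcLeft l τ}) ∧
    -- the costate is the gradient of the value function, which solves the
    -- Hamilton-Jacobi-Bellman equation, and the control `-sign λ₂` is the unique optimal one
    (∀ θ ∈ usableAngles, ∀ τ, 0 < τ →
      HasFDerivAt (value l)
        ((charCostate l θ τ).1 • ContinuousLinearMap.fst ℝ ℝ ℝ +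
          (charCostate l θ τ).2 • ContinuousLinearMap.snd ℝ ℝ ℝ) (charState l θ τ) ∧
      optHamiltonian (charState l θ τ) (charCostate l θ τ) = 0 ∧
      IsTrajectory (fun t => -Real.sign (charCostate l θ (τ - t)).2)
        (fun t => charState l θ (τ - t)) (charState l θ τ) τ ∧
      (∀ u x, IsTrajectory u x (charState l θ τ) τ → x τ ∈ circleTarget l →
        (∀ᵐ t ∂(volume.restrict (Icc 0 τ)), u t = -Real.sign (charCostate l θ (τ - t)).2) ∧
        ∀ t ∈ Icc 0 τ, x t = charState l θ (τ - t)) ∧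
      feedback l (charState l θ τ) = -Real.sign (charCostate l θ τ).2) ∧
    -- optimal synthesis: the feedback law steers every state outside the target to the target in
    -- minimum time, and a motion outside the target loses no time if and only if it obeys the law
    (∀ x₀ ∈ exterior l, ∃ T u x, IsTrajectory u x x₀ T ∧ (∀ t ∈ Ico 0 T, x t ∈ exterior l) ∧
      x T ∈ circleTarget l ∧ IsLeast (reachTimes l x₀) T ∧
      ∀ᵐ t ∂(volume.restrict (Icc 0 T)), u t = feedback l (x t)) ∧
    (∀ x₀ ∈ exterior l, ∀ T u x, IsTrajectory u x x₀ T → (∀ t ∈ Ico 0 T, x t ∈ exterior l) →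
      (value l (x T) = value l x₀ - T ↔
        ∀ᵐ t ∂(volume.restrict (Icc 0 T)), u t = feedback l (x t))) := by
  refine ⟨⟨UP_eq hl hl1, BUP_eq hl hl1, NUP_eq hl hl1⟩,
    fun θ hθ x p => isCharacteristic_iff hl hl1 hθ x p, ?_, ?_, ?_, ?_, ?_, ?_, ?_, ?_,
    tendsto_switch1 l, tendsto_switch2 l, switch1_image hl, switch2_image hl,
    bijOn_charState hl hl1, fun x₀ hx₀ => ⟨_, isLeast_value hl hl1 hx₀⟩,
    fun τ hτ => setOf_isLeast_eq hl hl1 hτ, ?_, ?_, ?_⟩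
  · intro θ hθ τ hτ h
    rw [charState_eq_extremal (.inl hθ) hτ]
    exact parabola_before_switch hθ hτ h
  · intro θ hθ τ hτ
    rw [charState_eq_extremal (.inl ⟨by linarith [hθ.1, pi_pos], hθ.2⟩)
      ((neg_tan_pos hθ).le.trans hτ)]
    exact parabola_after_switch hθ hτ
  · intro θ hθ τ hτ h
    -- The statement for θ - π, reflected through the origin; tan is unchanged by this shift.
    have h1 := parabola_before_switch (l := l) (sub_pi_mem hθ) hτ fun hc => by
      rw [tan_sub_pi]; exact h (by linarith)
    rw [sin_sub_pi, cos_sub_pi] at h1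
    rw [charState_eq_extremal (.inr hθ) hτ, extremal_eq_neg_sub_pi]
    simp only [Prod.fst_neg, Prod.snd_neg]
    linear_combination -h1
  · intro θ hθ τ hτ
    have hθ' := sub_pi_mem_upper hθ
    have h1 := parabola_after_switch (l := l) hθ' (τ := τ) (by rwa [tan_sub_pi])
    have h2 := (neg_tan_pos hθ').le
    rw [tan_sub_pi] at h1 h2
    rw [sin_sub_pi, cos_sub_pi, div_neg] at h1
    rw [charState_eq_extremal (.inr ⟨by linarith [hθ.1, pi_pos], hθ.2⟩) (h2.trans hτ),
      extremal_eq_neg_sub_pi]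
    simp only [Prod.fst_neg, Prod.snd_neg]
    linear_combination -h1
  · intro θ hθ τ hτ
    have hθ' : θ ∈ Ioo 0 π := ⟨hθ.1, by linarith [hθ.2, pi_pos]⟩
    rw [charCostate_snd]
    exact mul_pos (inv_pos.2 (costate_denominator_pos hl hl1 (sin_ne_zero_of_mem (.inl hθ'))))
      (switchFun_pos hθ' hτ fun hc => absurd hθ.2 (not_le.2 hc))
  · intro θ hθ τ hτ
    have hθ' : θ ∈ Ioo π (2 * π) := ⟨hθ.1, by linarith [hθ.2, pi_pos]⟩
    have h1 := switchFun_pos (sub_pi_mem hθ') hτ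
      fun hc => absurd hθ.2 (not_le.2 (by linarith))
    have h2 := switchFun_add_pi (θ - π) τ
    rw [sub_add_cancel] at h2
    rw [charCostate_snd]
    exact mul_neg_of_pos_of_neg
      (inv_pos.2 (costate_denominator_pos hl hl1 (sin_ne_zero_of_mem (.inr hθ')))) (by linarith)
  · intro θ hθ
    have hθ' : θ ∈ usableAngles := .inl ⟨by linarith [hθ.1, pi_pos], hθ.2⟩
    have hcos := cos_neg_of_mem hθ
    refine ⟨neg_tan_pos hθ, ?_, fun τ _ => ?_⟩
    · rw [charState_eq_extremal hθ' (neg_tan_pos hθ).le, extremal_neg_tan hθ]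
    · rw [sign_charCostate hl hl1 (sin_ne_zero_of_mem hθ'), switchFun_eq_cos_mul hcos.ne,
        ← sign_mul_of_pos (neg_pos.2 hcos) (-tan θ - τ)]
      ring_nf
  · intro θ hθ
    have hθ' : θ ∈ usableAngles := .inr ⟨by linarith [hθ.1, pi_pos], hθ.2⟩
    have hθ'' := sub_pi_mem_upper hθ
    have hcos := cos_neg_of_mem hθ''
    have htan := neg_tan_pos hθ''
    have hsw := extremal_neg_tan (l := l) hθ''
    rw [tan_sub_pi] at htan hsw
    rw [cos_sub_pi, neg_lt_zero] at hcos
    refine ⟨htan, ?_, fun τ _ => ?_⟩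
    · rw [charState_eq_extremal hθ' htan.le, switch2_eq_neg, ← hsw, extremal_eq_neg_sub_pi]
    · rw [sign_charCostate hl hl1 (sin_ne_zero_of_mem hθ'), switchFun_eq_cos_mul hcos.ne',
        sign_mul_of_pos hcos, add_comm]
  · intro θ hθ τ hτ
    have hsin := sin_ne_zero_of_mem hθ
    simp only [sign_charCostate hl hl1 hsin, charState_eq_extremal hθ hτ.le]
    refine ⟨hasFDerivAt_value_extremal hl hl1 hsin hτ, optHamiltonian_extremal hl hl1 hsin τ,
      (isTrajectory_extremal l θ hτ.le).congr fun t ht =>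
        charState_eq_extremal hθ (sub_nonneg.2 ht.2), fun u x hx hxτ => ?_,
      feedback_extremal hl hl1 (usableAngles_subset hθ) hτ⟩
    obtain ⟨h1, h2⟩ := hx.rigidity hl.le (mem_disc_of_mem_circleTarget hxτ)
    refine ⟨h1, fun t ht => ?_⟩
    rw [h2 t ht, charState_eq_extremal hθ (sub_nonneg.2 ht.2)]
  · intro x₀ hx₀
    obtain ⟨θ, hθ, τ, hτ, rfl⟩ := exists_extremal_mem_Ico hl hx₀
    refine ⟨τ, _, _, isTrajectory_extremal l θ hτ.le,
      fun t ht => extremal_mem_exterior hl hl1 θ (sub_pos.2 ht.2), ?_,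
      isLeast_extremal hl hl1 θ hτ.le, ?_⟩
    · rw [sub_self, extremal_zero]
      exact circlePoint_mem_circleTarget l θ
    · rw [ae_restrict_iff' measurableSet_Icc]
      have hne : ∀ᵐ t : ℝ, t ≠ τ := by simp [ae_iff]
      filter_upwards [hne] with t h1 ht
      rw [feedback_extremal hl hl1 hθ (sub_pos.2 (lt_of_le_of_ne ht.2 h1))]
  · intro x₀ hx₀ T u x hx hext
    exact ⟨hx.feedback_of_value_eq hl hl1 hx₀ hext, hx.value_eq_of_feedback hl hl1 hx₀ hext⟩
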